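/- **Theorem (Logarithmic number of collisions under $\rho^{\mathrm{RAND}}$).** *Model.* Let $1\le U\le C$, and let $\mu_1,\dots,\mu_C\in(0,1)$ be distinct. There are $U$ users, $C$ channels and slots $1,2,\dots$. Channel $i$ is free in slot $k$ iff $W_i(k)=1$, where the $W_i(k)$ are independent Bernoulli variables with means $\mu_i$. In each slot every user senses exactly one channel and observes whether it is free. A user *collides* in a slot if another user senses the same channel in that slot. For a vector $g\in\mathbb R^C$ let $\sigma(T;g)$ be the index of the $T$-th highest entry of $g$ (ties broken by an arbitrary fixed rule). The *$U$-best channels* are $\sigma(1;\mu),\dots,\sigma(U;\mu)$. *Policy.* After $k$ slots let $T_{i,j}(k)$ be the number of slots in which user $j$ sensed channel $i$, let $\bar X_{i,j}(k)$ be the fraction of those slots in which the channel was free, and $$g_j(i;k)=\bar X_{i,j}(k)+\sqrt{\frac{2\log k}{T_{i,j}(k)}}\qquad(\text{defined when }T_{i,j}(k)>0).$$ In slots $1,\dots,C$ each user senses every channel once, in an arbitrary fixed order of its own. Then every user has rank $1$ and no collision is on record. In each slot $k>C$, a user that collided in slot $k-1>C$ draws a new rank uniformly from $\{1,\dots,U\}$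 (all draws independent of each other and of the $W_i(k)$), any other user keeps its rank, and user $j$ with rank $r$ senses the channel $\sigma(r;g_j(\cdot\,;k-1))$. *Quantities.* $M(n)$ is the number of pairs (user, slot $\le n$) for which the user collides in a $U$-best channel. $T'(n)$ is the number of slots $k\le n$ such that for some user $j$ the top-$U$ estimated ranks are not correct, that is, not all $g_j(i;k-1)$ are defined (the case exactly for $k\le C$) or $\sigma(r;g_j(\cdot\,;k-1))\ne\sigma(r;\mu)$ for some $r\le U$. Finally, consider the Markov chain on the assignments of the $U$ users to $U$ channels that moves from an assignment to a uniformly chosen one among those in which every user who was alone in its channel keeps that channel; the assignments without shared channels are absorbing. $\mathbb E[\Upsilon(U,U)]$ is the maximum, over all initial distributions, of its expected time to absorption. *Claim.* $\mathbb E[\Upsilon(U,U)]<\infty$, for every $n$ $$\mathbb E[M(n)]\le U\,\bigl(\mathbb E[\Upsilon(U,U)]+1\bigr)\,\mathbb E[T'(n)],$$ and $\mathbb E[M(n)]=O(\log n)$ as $n\to\infty$, with constants that depend only on $U$, $C$ and $\mu$. -/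

import Mathlib

open MeasureTheory ProbabilityTheory
open scoped ENNReal

noncomputable section

namespace RhoRand

/-! ### The Markov chain of `U` users randomizing over `U` channels -/

/-- A configuration: user `j` occupies channel `x j`. -/
abbrev Config (U : ℕ) : Type := Fin U → Fin U

/-- User `j` is the only occupant of its channel. -/
def IsLone {U : ℕ} (x : Config U) (j : Fin U) : Prop := ∀ j', j' ≠ j → x j' ≠ x j

instance {U : ℕ} (x : Config U) (j : Fin U) : Decidable (IsLone x j) := by
  unfold IsLone; infer_instance

/-- The configurations reachable in one step: the lone users keep their channels. -/
def successors {U : ℕ} (x : Config U) : Finset (Config U) :=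
  Finset.univ.filter fun y => ∀ j, IsLone x j → y j = x j

theorem successors_nonempty {U : ℕ} (x : Config U) : (successors x).Nonempty :=
  ⟨x, by simp [successors]⟩

/-- The transition law: uniform over the reachable configurations. -/
def step {U : ℕ} (x : Config U) : PMF (Config U) :=
  PMF.uniformOfFinset (successors x) (successors_nonempty x)

/-- The transition kernel of the chain. -/
def stepKernel (U : ℕ) : Kernel (Config U) (Config U) where
  toFun x := (step x).toMeasure
  measurable' := measurable_of_countable _

instance (U : ℕ) : IsMarkovKernel (stepKernel U) :=
  ⟨fun x => inferInstanceAs (IsProbabilityMeasure (step x).toMeasure)⟩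

/-- The same kernel, as a function of the past trajectory (it reads the last state only). -/
def pathKernel (U n : ℕ) :
    Kernel ((i : Finset.Iic n) → (fun _ : ℕ => Config U) i) (Config U) :=
  (stepKernel U).comap (fun past => past ⟨n, Finset.mem_Iic.2 le_rfl⟩) (measurable_pi_apply _)

instance (U n : ℕ) : IsMarkovKernel (pathKernel U n) := by
  unfold pathKernel; infer_instance

/-- The law of the trajectory of the chain with initial distribution `ν`. -/
def chainLaw (U : ℕ) (ν : Measure (Config U)) : Measure (ℕ → Config U) :=
  Kernel.trajMeasure (X := fun _ => Config U) ν (pathKernel U)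

/-- The first time at which the configuration is orthogonal (no two users share a channel);
`∞` if there is none. -/
def absorptionTime {U : ℕ} (x : ℕ → Config U) : ℝ≥0∞ :=
  ⨅ (t : ℕ) (_ : Function.Injective (x t)), (t : ℝ≥0∞)

/-- `E[Υ(U,U)]`: the largest expected absorption time over all initial distributions. -/
def expectedUpsilon (U : ℕ) : ℝ≥0∞ :=
  ⨆ ν : ProbabilityMeasure (Config U), ∫⁻ x, absorptionTime x ∂(chainLaw U (ν : Measure (Config U)))

/-! ### The policy -/

/-- `σ g T` is the index of the `T`-th highest entry of `g` (`T` counted from `0`);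
ties are broken in an arbitrary fixed way. -/
def IsRankingRule {C : ℕ} (σ : (Fin C → ℝ) → Equiv.Perm (Fin C)) : Prop :=
  ∀ g : Fin C → ℝ, Antitone (g ∘ σ g)

/-- What is recorded after a number of slots, for every user `j` and channel `i`. -/
structure State (U C : ℕ) where
  /-- the number of slots in which user `j` sensed channel `i` -/
  sensed : Fin U → Fin C → ℕ
  /-- the number of those slots in which the channel was found free -/
  free : Fin U → Fin C → ℕ
  /-- the current rank of user `j` (counted from `0`) -/
  rank : Fin U → Fin U
  /-- the collision indicator of user `j` for the previous slot -/
  collided : Fin U → Bool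

/-- The statistic `g_j^MEAN(i; k)` after `k` slots: sample mean plus exploration term. It is
meaningful for `sensed j i > 0` only. -/
def gMean {U C : ℕ} (s : State U C) (k : ℕ) (j : Fin U) (i : Fin C) : ℝ :=
  (s.free j i : ℝ) / (s.sensed j i : ℝ) + √(2 * Real.log (k : ℝ) / (s.sensed j i : ℝ))

section Policy

variable {U C : ℕ} [NeZero U] (hUC : U ≤ C)
  (σ : (Fin C → ℝ) → Equiv.Perm (Fin C)) (init : Fin U → Equiv.Perm (Fin C))

/-- The rank user `j` uses in a slot: a new one is drawn exactly after a collision. -/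
def slotRank (s : State U C) (d : Fin U → Fin U) (j : Fin U) : Fin U :=
  if s.collided j then d j else s.rank j

/-- The channel that user `j` senses in slot `k + 1`, given the state `s` after `k` slots. In the
first `C` slots the user senses every channel once, in its own order `init j`; afterwards it senses
the channel whose estimated rank is its current rank. -/
def slotChannel (k : ℕ) (s : State U C) (d : Fin U → Fin U) (j : Fin U) : Fin C :=
  if h : k < C then init j ⟨k, h⟩
  else σ (gMean s k j) (Fin.castLE hUC (slotRank s d j))

/-- User `j` shares its channel with another user. -/
def Collides {U C : ℕ} (ch : Fin U → Fin C) (j : Fin U) : Prop := ∃ j', j' ≠ j ∧ ch j' = ch j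

instance {U C : ℕ} (ch : Fin U → Fin C) (j : Fin U) : Decidable (Collides ch j) := by
  unfold Collides; infer_instance

/-- The state after `k` slots, for a realization `w` of the channel availabilities and `d` of the
rank draws; `w k`, `d k` belong to slot `k + 1`. Collisions during the initial phase do not set the
collision indicators, and the first rank of every user is the top rank. -/
def stateAfter (w : ℕ → Fin C → Bool) (d : ℕ → Fin U → Fin U) : ℕ → State U C
  | 0 => ⟨fun _ _ => 0, fun _ _ => 0, fun _ => 0, fun _ => false⟩
  | k + 1 =>
    let s := stateAfter w d k
    let ch := slotChannel hUC σ init k s (d k)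
    { sensed := fun j i => s.sensed j i + if ch j = i then 1 else 0
      free := fun j i => s.free j i + if ch j = i ∧ w k i = true then 1 else 0
      rank := slotRank s (d k)
      collided := fun j => decide (C ≤ k ∧ Collides ch j) }

/-- The channel sensed by user `j` in slot `k + 1`. -/
def channel (w : ℕ → Fin C → Bool) (d : ℕ → Fin U → Fin U) (k : ℕ) (j : Fin U) : Fin C :=
  slotChannel hUC σ init k (stateAfter hUC σ init w d k) (d k) j

/-- `i` is one of the `U`-best channels. -/
def IsBest (μ : Fin C → ℝ) (i : Fin C) : Prop := ∃ r : Fin U, σ μ (Fin.castLE hUC r) = i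

instance (μ : Fin C → ℝ) (i : Fin C) : Decidable (IsBest hUC σ μ i) := by
  unfold IsBest; infer_instance

/-- `M(n)`: the number of collisions faced by the users in the `U`-best channels in `n` slots. -/
def collisions (μ : Fin C → ℝ) (w : ℕ → Fin C → Bool) (d : ℕ → Fin U → Fin U) (n : ℕ) : ℕ :=
  ∑ k ∈ Finset.range n, (Finset.univ.filter fun j : Fin U =>
    IsBest hUC σ μ (channel hUC σ init w d k j) ∧ Collides (channel hUC σ init w d k) j).card

/-- In state `s` after `k` slots, user `j` has a statistic for every channel and its estimated
top-`U` ranks are the true ones. -/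
def RanksCorrect (μ : Fin C → ℝ) (k : ℕ) (s : State U C) (j : Fin U) : Prop :=
  (∀ i, 0 < s.sensed j i) ∧
    ∀ r : Fin U, σ (gMean s k j) (Fin.castLE hUC r) = σ μ (Fin.castLE hUC r)

instance (μ : Fin C → ℝ) (k : ℕ) (s : State U C) (j : Fin U) :
    Decidable (RanksCorrect hUC σ μ k s j) := by
  unfold RanksCorrect; infer_instance

/-- `T'(n)`: the number of slots among the first `n` at whose beginning the top-`U` ranks are not
correctly estimated at some user. -/
def wrongSlots (μ : Fin C → ℝ) (w : ℕ → Fin C → Bool) (d : ℕ → Fin U → Fin U) (n : ℕ) : ℕ :=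
  ((Finset.range n).filter fun k =>
    ∃ j : Fin U, ¬ RanksCorrect hUC σ μ k (stateAfter hUC σ init w d k) j).card

end Policy

/-! ### The random inputs -/

/-- `W k i` tells whether channel `i` is free in slot `k + 1` and `D k j` is the rank that user `j`
draws for slot `k + 1` (if it needs one): all of these are independent, `W k i` is Bernoulli with
mean `μ i`, and `D k j` is uniform on the `U` ranks. -/
structure IsModel {Ω : Type*} [MeasurableSpace Ω] (P : Measure Ω) {U C : ℕ} (μ : Fin C → ℝ)
    (W : ℕ → Fin C → Ω → Bool) (D : ℕ → Fin U → Ω → Fin U) : Prop where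
  measurable_W : ∀ k i, Measurable (W k i)
  measurable_D : ∀ k j, Measurable (D k j)
  law_W : ∀ k i, P {ω | W k i ω = true} = ENNReal.ofReal (μ i)
  law_D : ∀ k j r, P {ω | D k j ω = r} = (U : ℝ≥0∞)⁻¹
  indep_W : iIndepFun (fun p : ℕ × Fin C => W p.1 p.2) P
  indep_D : iIndepFun (fun p : ℕ × Fin U => D p.1 p.2) P
  indep_WD : IndepFun (fun ω (p : ℕ × Fin C) => W p.1 p.2 ω)
    (fun ω (p : ℕ × Fin U) => D p.1 p.2 ω) P

end RhoRand

end

noncomputable section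

namespace RhoRand

/-! ### The absorption time of the randomization chain -/

/-! Finiteness. The lone users occupy distinct channels, so every configuration has an injective
successor, and the uniform step hits it with probability at least `U ^ (-U)`. The absorption time
therefore has a geometric tail, uniformly in the start (`survival_le_pow`).

First inequality. While every user has the correct top ranks, the sensed channel is one common
injective function of the rank. Users then collide iff they share a rank, and the rank vector makes
exactly one step of the chain (`AllCorrect.runRank_succ`, `sum_redraw`). First-step analysis turns
`meanAbsorption` into a potential whose expected drop over a correct slot is the probability of a
non-injective rank vector. The potential never exceeds `expectedUpsilon U`, and only a wrong slot
can raise it on average. Telescoping bounds the expected number of correct slots with a collision by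
`expectedUpsilon U` times that of wrong slots. A slot contributes at most `U` collisions, and the
wrong slots themselves account for the `+ 1`.

Logarithmic bound. It is obtained directly, without estimating the expectation of `T'(n)`. For a
horizon `n`, call a slot regular if all confidence bounds hold and every user senses a channel of
which it already has `L` samples, with `L` of order `log n`. Irregular slots are few: an exponential
supermartingale and a union bound over the sample counts give failure probabilities of order `k ^
(-3)`, and a user can sense a given channel at most `L` times while it has fewer than `L` samples of
it.

Over consecutive regular slots a user that did not collide stays on its channel
(`Regular.runChannel_succ`), so absence of collisions persists until the next irregular slot.
Conversely, after a regular slot with a collision, suitable draws in the next two slots produce an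
irregular slot or a collision-free one (`Active.exists_draw`). If no user has an undersampled
channel among its top ranks, all top rankings are correct and the colliding users can take the free
ranks. If a colliding user has one, it can draw its rank. If only a non-colliding user has one, a
colliding user can run into it and so make it draw in the following slot. A prescribed draw has
probability `U ^ (-U)`; hence the expected number of regular slots with a collision is at most `U ^
(2 * U)` times three times that of irregular slots plus one. -/

/-- The probability that the chain started at `x` is not orthogonal at any of the times
`0, …, t`. -/
def survival {U : ℕ} : ℕ → Config U → ℝ≥0∞
  | 0, x => if Function.Injective x then 0 else 1
  | t + 1, x => if Function.Injective x then 0 else ∑ y, step x y * survival t y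

/-- The expected absorption time of the chain started at `x`. -/
def meanAbsorption {U : ℕ} (x : Config U) : ℝ≥0∞ := ∑' t, survival t x

theorem isLone_of_injective {U : ℕ} {x : Config U} (hx : Function.Injective x) (j : Fin U) :
    IsLone x j := fun _ hj h => hj (hx h)

theorem successors_of_injective {U : ℕ} {x : Config U} (hx : Function.Injective x) :
    successors x = {x} := by
  ext y
  simp only [successors, Finset.mem_filter, Finset.mem_univ, true_and, Finset.mem_singleton]
  exact ⟨fun h => funext fun j => h j (isLone_of_injective hx j), fun h _ _ => h ▸ rfl⟩

theorem step_apply_of_mem {U : ℕ} {x y : Config U} (h : y ∈ successors x) :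
    step x y = ((successors x).card : ℝ≥0∞)⁻¹ :=
  PMF.uniformOfFinset_apply_of_mem _ h

theorem sum_step {U : ℕ} (x : Config U) : ∑ y, step x y = 1 := by
  rw [← tsum_fintype (L := .unconditional _), PMF.tsum_coe]

theorem survival_of_injective {U : ℕ} {x : Config U} (hx : Function.Injective x) (t : ℕ) :
    survival t x = 0 := by
  cases t <;> simp [survival, hx]

theorem meanAbsorption_of_injective {U : ℕ} {x : Config U} (hx : Function.Injective x) :
    meanAbsorption x = 0 := by
  simp [meanAbsorption, survival_of_injective hx]

/-- One-step analysis of the expected absorption time. -/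
theorem meanAbsorption_eq {U : ℕ} (x : Config U) :
    meanAbsorption x =
      (if Function.Injective x then 0 else 1) + ∑ y, step x y * meanAbsorption y := by
  by_cases hx : Function.Injective x
  · rw [meanAbsorption_of_injective hx]
    symm
    simp only [hx, if_true, zero_add]
    refine Finset.sum_eq_zero fun y _ => ?_
    by_cases hy : y ∈ successors x
    · rw [successors_of_injective hx, Finset.mem_singleton] at hy
      rw [hy, meanAbsorption_of_injective hx, mul_zero]
    · rw [step, PMF.uniformOfFinset_apply_of_notMem _ hy, zero_mul]
  · simp only [hx, if_false]
    have h1 : ∑' t, survival t x = survival 0 x + ∑' t, survival (t + 1) x :=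
      tsum_eq_zero_add' (f := fun t => survival t x) ENNReal.summable
    have h2 : ∑' t, ∑ y, step x y * survival t y = ∑ y, ∑' t, step x y * survival t y :=
      Summable.tsum_finsetSum (fun _ _ => ENNReal.summable)
    rw [meanAbsorption, h1]
    simp only [survival, hx, if_false, h2, ENNReal.tsum_mul_left]
    rfl

/-- A partial assignment without shared values extends to an injective one. -/
theorem exists_injective_extension {U : ℕ} (x : Config U) (s : Set (Fin U)) (hs : Set.InjOn x s) :
    ∃ y : Config U, Function.Injective y ∧ ∀ j ∈ s, y j = x j := by
  classical
  obtain ⟨e, he⟩ := Finset.exists_equiv_extend_of_card_eq (t := Finset.univ) (f := x)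
    (s := s.toFinset) (α := Fin U) (β := Fin U) (by simp) (by simp) (by simpa using hs)
  refine ⟨fun j => (e j : Fin U), fun a b h => e.injective (Subtype.ext h), fun j hj => ?_⟩
  exact he j (by simpa using hj)

theorem injOn_setOf_isLone {U : ℕ} (x : Config U) : Set.InjOn x {j | IsLone x j} := by
  intro a ha b _ hab
  by_contra hne
  exact ha b (Ne.symm hne) hab.symm

/-- Keeping the lone users and completing injectively gives a reachable absorbing configuration `z`.
Since there are at most `U ^ U` successors, each step is absorbed with probability at least `U ^
(-U)`. -/
theorem survival_le_pow {U : ℕ} [NeZero U] (t : ℕ) (x : Config U) :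
    survival t x ≤ (1 - ((U : ℝ≥0∞) ^ U)⁻¹) ^ t := by
  induction t generalizing x with
  | zero => simp only [survival, pow_zero]; split_ifs <;> simp
  | succ t ih =>
    simp only [survival]
    split_ifs with hx
    · exact zero_le
    obtain ⟨z, hz, hzx⟩ := exists_injective_extension x _ (injOn_setOf_isLone x)
    have hmem : z ∈ successors x := by simpa [successors] using hzx
    have hcard : ((U : ℝ≥0∞) ^ U)⁻¹ ≤ step x z := by
      rw [step_apply_of_mem hmem]
      refine ENNReal.inv_le_inv.2 ?_
      have : (successors x).card ≤ U ^ U := by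
        simpa using Finset.card_le_univ (successors x)
      exact_mod_cast this
    have hne : step x z ≠ ∞ := PMF.apply_ne_top _ _
    calc ∑ y, step x y * survival t y
        = ∑ y ∈ Finset.univ.erase z, step x y * survival t y := by
          rw [← Finset.add_sum_erase _ _ (Finset.mem_univ z), survival_of_injective hz, mul_zero,
            zero_add]
      _ ≤ ∑ y ∈ Finset.univ.erase z, step x y * (1 - ((U : ℝ≥0∞) ^ U)⁻¹) ^ t :=
          Finset.sum_le_sum fun y _ => mul_le_mul_right (ih y) _
      _ = (1 - step x z) * (1 - ((U : ℝ≥0∞) ^ U)⁻¹) ^ t := by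
          rw [← Finset.sum_mul]
          congr 1
          refine ENNReal.eq_sub_of_add_eq hne ?_
          rw [add_comm, Finset.add_sum_erase _ _ (Finset.mem_univ z), sum_step]
      _ ≤ (1 - ((U : ℝ≥0∞) ^ U)⁻¹) ^ (t + 1) := by
          rw [pow_succ']
          exact mul_le_mul_left (tsub_le_tsub_left hcard 1) _

theorem meanAbsorption_le {U : ℕ} [NeZero U] (x : Config U) : meanAbsorption x ≤ (U : ℝ≥0∞) ^ U := by
  have h0 : ((U : ℝ≥0∞) ^ U)⁻¹ ≤ 1 := by
    rw [ENNReal.inv_le_one]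
    exact_mod_cast Nat.one_le_pow _ _ (NeZero.pos U)
  calc meanAbsorption x ≤ ∑' t, (1 - ((U : ℝ≥0∞) ^ U)⁻¹) ^ t :=
        ENNReal.tsum_le_tsum fun t => survival_le_pow t x
    _ = (U : ℝ≥0∞) ^ U := by
        rw [ENNReal.tsum_geometric, ENNReal.sub_sub_cancel ENNReal.one_ne_top h0, inv_inv]

/-! ### The trajectory measure of the chain and its absorption time -/

section Law

variable {U : ℕ} (ν : Measure (Config U))

instance [IsProbabilityMeasure ν] : IsProbabilityMeasure (chainLaw U ν) := by
  unfold chainLaw; infer_instance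

theorem lintegral_chainLaw_zero (f : Config U → ℝ≥0∞) :
    ∫⁻ x, f (x 0) ∂(chainLaw U ν) = ∫⁻ x, f x ∂ν := by
  have h : (chainLaw U ν).map (Preorder.frestrictLe (π := fun _ => Config U) 0) =
      ν.map (MeasurableEquiv.piUnique (fun i : Finset.Iic 0 => Config U)).symm := by
    rw [chainLaw, Kernel.trajMeasure, Measure.map_comp _ _ (by fun_prop),
      Kernel.traj_map_frestrictLe, Kernel.partialTraj_self, Measure.id_comp]
  have h2 : ∫⁻ x, f (x 0) ∂(chainLaw U ν) =
      ∫⁻ y, f (y ⟨0, by simp⟩) ∂((chainLaw U ν).map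
        (Preorder.frestrictLe (π := fun _ => Config U) 0)) := by
    rw [lintegral_map (Measurable.of_discrete) (by fun_prop)]
    rfl
  rw [h2, h, lintegral_map Measurable.of_discrete (MeasurableEquiv.measurable _)]
  rfl

/-- The Markov property, tested against products of a function of the past and a function of the
next state. -/
theorem lintegral_chainLaw_succ [IsProbabilityMeasure ν] (t : ℕ) (G : ((i : Finset.Iic t) → Config U) → ℝ≥0∞)
    (f : Config U → ℝ≥0∞) :
    ∫⁻ x, G (Preorder.frestrictLe (π := fun _ => Config U) t x) * f (x (t + 1)) ∂(chainLaw U ν) =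
      ∫⁻ x, G (Preorder.frestrictLe (π := fun _ => Config U) t x) * ∑ y, step (x t) y * f y
        ∂(chainLaw U ν) := by
  have key := Kernel.map_frestrictLe_trajMeasure_compProd_eq_map_trajMeasure
    (X := fun _ => Config U) (μ₀ := ν) (κ := pathKernel U) (a := t)
  have h := congrArg (fun m => ∫⁻ p, G p.1 * f p.2 ∂m) key
  beta_reduce at h
  rw [Measure.lintegral_compProd Measurable.of_discrete,
    lintegral_map Measurable.of_discrete (by fun_prop),
    lintegral_map Measurable.of_discrete (by fun_prop)] at h
  refine h.symm.trans (lintegral_congr fun x => ?_)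
  dsimp only
  rw [lintegral_const_mul _ Measurable.of_discrete]
  congr 1
  rw [pathKernel, Kernel.comap_apply]
  change ∫⁻ y, f y ∂(step (x t)).toMeasure = _
  rw [lintegral_fintype]
  refine Finset.sum_congr rfl fun y _ => ?_
  rw [PMF.toMeasure_apply_singleton _ _ (MeasurableSet.singleton y), mul_comm]

/-- The Markov property iterated `t` times: the recursion of `survival` is traded one step at a time
for an actual step of the trajectory. With `m = 0` it identifies `survival` as a tail probability.
-/
theorem lintegral_survival [IsProbabilityMeasure ν] (t m : ℕ) :
    ∫⁻ x, (if ∀ s < t, ¬ Function.Injective (x s) then survival m (x t) else 0) ∂(chainLaw U ν) =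
      ∫⁻ x, survival (t + m) x ∂ν := by
  induction t generalizing m with
  | zero => simpa using lintegral_chainLaw_zero ν (survival m)
  | succ t ih =>
    rw [show t + 1 + m = t + (m + 1) by ring, ← ih (m + 1)]
    classical
    let G : ((i : Finset.Iic t) → Config U) → ℝ≥0∞ :=
      fun z => if ∀ s : Finset.Iic t, ¬ Function.Injective (z s) then 1 else 0
    have hG : ∀ x : ℕ → Config U, G (Preorder.frestrictLe (π := fun _ => Config U) t x) =
        if ∀ s < t + 1, ¬ Function.Injective (x s) then 1 else 0 := by
      intro x
      simp only [G, Preorder.frestrictLe, Subtype.forall, Finset.mem_Iic, Nat.lt_succ_iff]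
      rfl
    calc ∫⁻ x, (if ∀ s < t + 1, ¬ Function.Injective (x s) then survival m (x (t + 1)) else 0)
          ∂(chainLaw U ν)
        = ∫⁻ x, G (Preorder.frestrictLe (π := fun _ => Config U) t x) * survival m (x (t + 1))
          ∂(chainLaw U ν) := by
          refine lintegral_congr fun x => ?_
          rw [hG]; split_ifs <;> simp
      _ = _ := by
          rw [lintegral_chainLaw_succ]
          refine lintegral_congr fun x => ?_
          rw [hG]
          by_cases h1 : ∀ s < t, ¬ Function.Injective (x s) <;>
            by_cases h2 : Function.Injective (x t) <;>
            simp only [Nat.forall_lt_succ_right, h1, h2, survival] <;> simp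

/-- Tail-sum formula: the term `t` is the indicator that absorption happens later than `t`. A
trajectory that is never absorbed gives `∞` on both sides. -/
theorem absorptionTime_eq_tsum (x : ℕ → Config U) :
    absorptionTime x =
      ∑' t, if ∀ s < t + 1, ¬ Function.Injective (x s) then (1 : ℝ≥0∞) else 0 := by
  classical
  unfold absorptionTime
  by_cases h : ∃ t, Function.Injective (x t)
  · have h1 : (⨅ (t : ℕ) (_ : Function.Injective (x t)), (t : ℝ≥0∞)) = (Nat.find h : ℝ≥0∞) := by
      refine le_antisymm (iInf₂_le (f := fun (t : ℕ) (_ : Function.Injective (x t)) =>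
        (t : ℝ≥0∞)) _ (Nat.find_spec h)) (le_iInf₂ fun t ht => ?_)
      exact_mod_cast Nat.find_min' h ht
    rw [h1, tsum_eq_sum (s := Finset.range (Nat.find h))]
    · rw [Finset.sum_congr rfl (g := fun _ => 1)]
      · simp
      · intro t ht
        rw [if_pos]
        intro s hs
        exact Nat.find_min h (by have := Finset.mem_range.1 ht; omega)
    · intro t ht
      rw [if_neg]
      intro hs
      exact hs _ (by have := Finset.mem_range.not.1 ht; omega) (Nat.find_spec h)
  · push Not at h
    simp [h]

theorem lintegral_absorptionTime [IsProbabilityMeasure ν] :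
    ∫⁻ x, absorptionTime x ∂(chainLaw U ν) = ∫⁻ x, meanAbsorption x ∂ν := by
  classical
  have hm : ∀ t : ℕ, Measurable fun x : ℕ → Config U =>
      if ∀ s < t + 1, ¬ Function.Injective (x s) then (1 : ℝ≥0∞) else 0 := by
    intro t
    refine Measurable.ite ?_ measurable_const measurable_const
    have : {x : ℕ → Config U | ∀ s < t + 1, ¬ Function.Injective (x s)} =
        ⋂ s : ℕ, ⋂ _ : s < t + 1, (fun x : ℕ → Config U => x s) ⁻¹' {z | ¬ Function.Injective z} := by
      ext; simp
    rw [this]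
    exact MeasurableSet.iInter fun s => MeasurableSet.iInter fun _ =>
      (measurable_pi_apply s) (Set.toFinite _).measurableSet
  simp_rw [absorptionTime_eq_tsum]
  unfold meanAbsorption
  rw [lintegral_tsum fun t => (hm t).aemeasurable,
    lintegral_tsum fun t => (Measurable.of_discrete).aemeasurable]
  refine tsum_congr fun t => ?_
  rw [← add_zero t, ← lintegral_survival ν t 0, add_zero]
  refine lintegral_congr fun x => ?_
  by_cases h1 : ∀ s < t, ¬ Function.Injective (x s) <;>
    by_cases h2 : Function.Injective (x t) <;>
    simp only [Nat.forall_lt_succ_right, h1, h2, survival] <;> simp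

end Law

/-- The Dirac mass at `x` is one of the initial distributions in the supremum. -/
theorem meanAbsorption_le_expectedUpsilon {U : ℕ} (x : Config U) :
    meanAbsorption x ≤ expectedUpsilon U := by
  refine le_trans ?_ (le_iSup _ (⟨Measure.dirac x, inferInstance⟩ : ProbabilityMeasure (Config U)))
  simp only [ProbabilityMeasure.coe_mk]
  rw [lintegral_absorptionTime, lintegral_dirac]

theorem expectedUpsilon_lt_top (U : ℕ) [NeZero U] : expectedUpsilon U < ∞ := by
  have : expectedUpsilon U ≤ (U : ℝ≥0∞) ^ U := by
    refine iSup_le fun ν => ?_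
    rw [lintegral_absorptionTime]
    calc ∫⁻ x, meanAbsorption x ∂(ν : Measure (Config U))
        ≤ ∫⁻ _, (U : ℝ≥0∞) ^ U ∂(ν : Measure (Config U)) := lintegral_mono meanAbsorption_le
      _ = (U : ℝ≥0∞) ^ U := by simp
  exact this.trans_lt (ENNReal.pow_lt_top (ENNReal.natCast_lt_top U))

/-! ### Resampling one slot of the random inputs -/

/-- The random input of one slot: the channel availabilities and the rank draws. -/
abbrev Input (U C : ℕ) : Type := (Fin C → Bool) × (Fin U → Fin U)

/-- The probability that a channel of mean `m` has availability `b`. -/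
def bernoulliWeight (m : ℝ) (b : Bool) : ℝ≥0∞ :=
  if b then ENNReal.ofReal m else ENNReal.ofReal (1 - m)

/-- The probability of a one-slot input. -/
def inputWeight {U C : ℕ} (μ : Fin C → ℝ) (x : Input U C) : ℝ≥0∞ :=
  (∏ i, bernoulliWeight (μ i) (x.1 i)) * ((U : ℝ≥0∞)⁻¹) ^ U

/-- The sequence of one-slot inputs of a realization. -/
def inputs {Ω : Type*} {U C : ℕ} (W : ℕ → Fin C → Ω → Bool) (D : ℕ → Fin U → Ω → Fin U) (ω : Ω) :
    ℕ → Input U C := fun k => (fun i => W k i ω, fun j => D k j ω)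

theorem sum_bernoulliWeight {m : ℝ} (hm : m ∈ Set.Ioo (0 : ℝ) 1) :
    ∑ b, bernoulliWeight m b = 1 := by
  simp only [Fintype.sum_bool, bernoulliWeight, if_true, Bool.false_eq_true, if_false]
  rw [← ENNReal.ofReal_add hm.1.le (by linarith [hm.2])]
  simp

theorem sum_prod_bernoulliWeight {C : ℕ} {μ : Fin C → ℝ} (hμ : ∀ i, μ i ∈ Set.Ioo (0 : ℝ) 1) :
    ∑ w : Fin C → Bool, ∏ i, bernoulliWeight (μ i) (w i) = 1 := by
  have h := (Finset.prod_univ_sum (fun _ : Fin C => (Finset.univ : Finset Bool))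
    (fun i b => bernoulliWeight (μ i) b)).symm
  rw [Fintype.piFinset_univ] at h
  rw [h]
  exact Finset.prod_eq_one fun i _ => sum_bernoulliWeight (hμ i)

theorem sum_prod_bernoulliWeight_mul {C : ℕ} {μ : Fin C → ℝ} (hμ : ∀ i, μ i ∈ Set.Ioo (0 : ℝ) 1)
    (i : Fin C) (f : Bool → ℝ≥0∞) :
    ∑ w : Fin C → Bool, (∏ i, bernoulliWeight (μ i) (w i)) * f (w i) =
      ∑ b, bernoulliWeight (μ i) b * f b := by
  classical
  -- Absorbing `f` into the factor of coordinate `i` makes the whole summand a product, so the sum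
  -- factorizes and the other coordinates sum to one.
  have h := (Finset.prod_univ_sum (fun _ : Fin C => (Finset.univ : Finset Bool))
    (fun i' b => bernoulliWeight (μ i') b * if i' = i then f b else 1)).symm
  rw [Fintype.piFinset_univ] at h
  have h2 : ∀ w : Fin C → Bool, (∏ i, bernoulliWeight (μ i) (w i)) * f (w i) =
      ∏ i', bernoulliWeight (μ i') (w i') * if i' = i then f (w i') else 1 := by
    intro w
    rw [Finset.prod_mul_distrib, Finset.prod_ite_eq' Finset.univ i (fun i' => f (w i'))]
    simp
  simp_rw [h2]
  rw [h, Finset.prod_eq_single i]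
  · simp
  · intro i' _ hi'
    simp only [hi', if_false, mul_one]
    exact sum_bernoulliWeight (hμ i')
  · simp

theorem sum_inputWeight_mul {U C : ℕ} {μ : Fin C → ℝ} (hμ : ∀ i, μ i ∈ Set.Ioo (0 : ℝ) 1)
    (i : Fin C) (f : (Fin U → Fin U) → Bool → ℝ≥0∞) :
    ∑ x : Input U C, inputWeight μ x * f x.2 (x.1 i) =
      ∑ d, ((U : ℝ≥0∞)⁻¹) ^ U * ∑ b, bernoulliWeight (μ i) b * f d b := by
  rw [Fintype.sum_prod_type_right]
  refine Finset.sum_congr rfl fun d _ => ?_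
  rw [← sum_prod_bernoulliWeight_mul hμ i (f d), Finset.mul_sum]
  refine Finset.sum_congr rfl fun w _ => ?_
  simp only [inputWeight]
  ring

theorem sum_inputWeight_mul_snd {U C : ℕ} {μ : Fin C → ℝ} (hμ : ∀ i, μ i ∈ Set.Ioo (0 : ℝ) 1)
    (f : (Fin U → Fin U) → ℝ≥0∞) :
    ∑ x : Input U C, inputWeight μ x * f x.2 = ∑ d, ((U : ℝ≥0∞)⁻¹) ^ U * f d := by
  rw [Fintype.sum_prod_type_right]
  refine Finset.sum_congr rfl fun d _ => ?_
  rw [← one_mul (((U : ℝ≥0∞)⁻¹) ^ U * f d), ← sum_prod_bernoulliWeight hμ, Finset.sum_mul]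
  refine Finset.sum_congr rfl fun w _ => ?_
  simp only [inputWeight]
  ring

theorem sum_uniformWeight (U : ℕ) [NeZero U] :
    ∑ _d : Fin U → Fin U, ((U : ℝ≥0∞)⁻¹) ^ U = 1 := by
  rw [Finset.sum_const, Finset.card_univ, Fintype.card_fun, Fintype.card_fin, nsmul_eq_mul,
    Nat.cast_pow, ← mul_pow, ENNReal.mul_inv_cancel, one_pow]
  · exact_mod_cast NeZero.ne U
  · exact ENNReal.natCast_ne_top U

/-- If two families are independent of each other, and each has a first part independent of its
second part, then the first parts are jointly independent of the second parts. -/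
theorem indepFun_prodMk_of_indepFun {Ω α α' β β' : Type*} [MeasurableSpace Ω] {P : Measure Ω}
    [IsProbabilityMeasure P] [MeasurableSpace α] [MeasurableSpace α'] [MeasurableSpace β]
    [MeasurableSpace β'] [Countable α] [Countable α'] [Countable β] [Countable β']
    [MeasurableSingletonClass α] [MeasurableSingletonClass α'] [MeasurableSingletonClass β]
    [MeasurableSingletonClass β'] {X : Ω → α} {X' : Ω → α'} {Y : Ω → β} {Y' : Ω → β'}
    (hX : Measurable X) (hX' : Measurable X') (hY : Measurable Y) (hY' : Measurable Y')
    (hXX : IndepFun X X' P) (hYY : IndepFun Y Y' P)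
    (hXY : IndepFun (fun ω => (X ω, X' ω)) (fun ω => (Y ω, Y' ω)) P) :
    IndepFun (fun ω => (X ω, Y ω)) (fun ω => (X' ω, Y' ω)) P := by
  rw [indepFun_iff_map_prod_eq_prod_map_map (by fun_prop) (by fun_prop)]
  refine Measure.ext_of_singleton fun z => ?_
  obtain ⟨⟨a, b⟩, ⟨a', b'⟩⟩ := z
  have e1 : (fun ω => ((X ω, Y ω), (X' ω, Y' ω))) ⁻¹' {((a, b), (a', b'))} =
      (fun ω => (X ω, X' ω)) ⁻¹' {(a, a')} ∩ (fun ω => (Y ω, Y' ω)) ⁻¹' {(b, b')} := by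
    ext ω; simp; tauto
  have e2 : (fun ω => (X ω, X' ω)) ⁻¹' {(a, a')} = X ⁻¹' {a} ∩ X' ⁻¹' {a'} := by
    ext ω; simp
  have e3 : (fun ω => (Y ω, Y' ω)) ⁻¹' {(b, b')} = Y ⁻¹' {b} ∩ Y' ⁻¹' {b'} := by
    ext ω; simp
  have e4 : (fun ω => (X ω, Y ω)) ⁻¹' {(a, b)} = X ⁻¹' {a} ∩ Y ⁻¹' {b} := by
    ext ω; simp
  have e5 : (fun ω => (X' ω, Y' ω)) ⁻¹' {(a', b')} = X' ⁻¹' {a'} ∩ Y' ⁻¹' {b'} := by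
    ext ω; simp
  have hXY1 : IndepFun X Y P := hXY.comp measurable_fst measurable_fst
  have hXY2 : IndepFun X' Y' P := hXY.comp measurable_snd measurable_snd
  rw [← Set.singleton_prod_singleton, Measure.prod_prod, Set.singleton_prod_singleton,
    Measure.map_apply (by fun_prop) (MeasurableSet.singleton _),
    Measure.map_apply (by fun_prop) (MeasurableSet.singleton _),
    Measure.map_apply (by fun_prop) (MeasurableSet.singleton _), e1,
    hXY.measure_inter_preimage_eq_mul _ _ (MeasurableSet.singleton _) (MeasurableSet.singleton _),
    e2, e3, e4, e5,
    hXX.measure_inter_preimage_eq_mul _ _ (MeasurableSet.singleton _) (MeasurableSet.singleton _),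
    hYY.measure_inter_preimage_eq_mul _ _ (MeasurableSet.singleton _) (MeasurableSet.singleton _),
    hXY1.measure_inter_preimage_eq_mul _ _ (MeasurableSet.singleton _) (MeasurableSet.singleton _),
    hXY2.measure_inter_preimage_eq_mul _ _ (MeasurableSet.singleton _) (MeasurableSet.singleton _)]
  ring

/-! ### One slot of input is independent of the past and can be averaged out -/

section Model

variable {Ω : Type*} [MeasurableSpace Ω] {P : Measure Ω} {U C : ℕ}
  {μ : Fin C → ℝ} {W : ℕ → Fin C → Ω → Bool} {D : ℕ → Fin U → Ω → Fin U}

theorem IsModel.measurable_inputs (hM : IsModel P μ W D) (k : ℕ) :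
    Measurable fun ω => inputs W D ω k :=
  (measurable_pi_lambda _ fun i => hM.measurable_W k i).prodMk
    (measurable_pi_lambda _ fun j => hM.measurable_D k j)

/-- Availabilities and draws each split into independent past and present; since the two families
are independent of each other, the pairs split as well. Only finitely many discrete variables are
involved, so the countable criterion applies. -/
theorem IsModel.indepFun_inputs [IsProbabilityMeasure P] (hM : IsModel P μ W D) (k : ℕ) :
    IndepFun (fun ω (s : Finset.range k) => inputs W D ω s) (fun ω => inputs W D ω k) P := by
  have hdis : ∀ α : Type, [Fintype α] → Disjoint (Finset.range k ×ˢ (Finset.univ : Finset α))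
      ({k} ×ˢ Finset.univ) := by
    intro α _
    rw [Finset.disjoint_left]
    rintro ⟨a, b⟩ h1 h2
    simp at h1 h2
    omega
  have hW := hM.indep_W.indepFun_finset _ _ (hdis (Fin C)) fun p => hM.measurable_W p.1 p.2
  have hD := hM.indep_D.indepFun_finset _ _ (hdis (Fin U)) fun p => hM.measurable_D p.1 p.2
  have hWD := hM.indep_WD.comp
    (φ := fun w : ℕ × Fin C → Bool =>
      ((fun p : ↥(Finset.range k ×ˢ (Finset.univ : Finset (Fin C))) => w p),
        fun p : ↥(({k} : Finset ℕ) ×ˢ (Finset.univ : Finset (Fin C))) => w p))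
    (ψ := fun d : ℕ × Fin U → Fin U =>
      ((fun p : ↥(Finset.range k ×ˢ (Finset.univ : Finset (Fin U))) => d p),
        fun p : ↥(({k} : Finset ℕ) ×ˢ (Finset.univ : Finset (Fin U))) => d p))
    (by fun_prop) (by fun_prop)
  have h := indepFun_prodMk_of_indepFun
    (measurable_pi_lambda _ fun p => hM.measurable_W _ _)
    (measurable_pi_lambda _ fun p => hM.measurable_W _ _)
    (measurable_pi_lambda _ fun p => hM.measurable_D _ _)
    (measurable_pi_lambda _ fun p => hM.measurable_D _ _) hW hD hWD
  exact h.comp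
    (φ := fun z (s : Finset.range k) =>
      ((fun i => z.1 ⟨(s.1, i), by simp⟩, fun j => z.2 ⟨(s.1, j), by simp⟩) :
        Input U C))
    (ψ := fun z => ((fun i => z.1 ⟨(k, i), by simp⟩, fun j => z.2 ⟨(k, j), by simp⟩) : Input U C))
    Measurable.of_discrete Measurable.of_discrete

theorem IsModel.measure_inputs_eq [IsProbabilityMeasure P] (hM : IsModel P μ W D) (hμ : ∀ i, μ i ∈ Set.Ioo (0 : ℝ) 1) (k : ℕ)
    (x : Input U C) : P {ω | inputs W D ω k = x} = inputWeight μ x := by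
  have h := hM.indep_WD.comp (φ := fun w : ℕ × Fin C → Bool => fun i => w (k, i))
    (ψ := fun d : ℕ × Fin U → Fin U => fun j => d (k, j)) (by fun_prop) (by fun_prop)
  have e : {ω | inputs W D ω k = x} =
      (fun ω i => W k i ω) ⁻¹' {x.1} ∩ (fun ω j => D k j ω) ⁻¹' {x.2} := by
    ext ω
    simp [inputs, Prod.ext_iff]
  have hW := hM.indep_W.precomp (g := fun i : Fin C => (k, i)) (fun _ _ h => (Prod.ext_iff.1 h).2)
  have hD := hM.indep_D.precomp (g := fun j : Fin U => (k, j)) (fun _ _ h => (Prod.ext_iff.1 h).2)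
  have eW : (fun ω i => W k i ω) ⁻¹' {x.1} = ⋂ i, W k i ⁻¹' {x.1 i} := by
    ext ω; simp [funext_iff]
  have eD : (fun ω i => D k i ω) ⁻¹' {x.2} = ⋂ i, D k i ⁻¹' {x.2 i} := by
    ext ω; simp [funext_iff]
  rw [e]
  refine (h.measure_inter_preimage_eq_mul _ _ (MeasurableSet.singleton _)
    (MeasurableSet.singleton _)).trans ?_
  rw [inputWeight]
  congr 1
  · refine (congrArg P eW).trans ?_
    rw [hW.meas_iInter fun i => ⟨{x.1 i}, MeasurableSet.singleton _, rfl⟩]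
    refine Finset.prod_congr rfl fun i _ => ?_
    have ht := hM.law_W k i
    have hmt : MeasurableSet {ω | W k i ω = true} :=
      hM.measurable_W k i (MeasurableSet.singleton true)
    have et : W k i ⁻¹' {true} = {ω | W k i ω = true} := by
      ext ω; simp
    rcases hb : x.1 i with _ | _
    · have hc : W k i ⁻¹' {false} = {ω | W k i ω = true}ᶜ := by
        ext ω; simp
      rw [hc, measure_compl hmt (measure_ne_top _ _), ht, measure_univ, ← ENNReal.ofReal_one,
        ← ENNReal.ofReal_sub _ (hμ i).1.le]
      simp [bernoulliWeight]
    · rw [et, ht]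
      simp [bernoulliWeight]
  · refine (congrArg P eD).trans ?_
    rw [hD.meas_iInter fun i => ⟨{x.2 i}, MeasurableSet.singleton _, rfl⟩]
    have ed : ∀ j, P (D k j ⁻¹' {x.2 j}) = (U : ℝ≥0∞)⁻¹ := by
      intro j
      rw [← hM.law_D k j (x.2 j)]
      congr 1
    simp [ed]

theorem _root_.DependsOn.exists_comp_restrict_range {α β : Type*} [Nonempty β] {f : (ℕ → α) → β}
    {k : ℕ} (hf : DependsOn f (Set.Iio k)) :
    ∃ G : (Finset.range k → α) → β, ∀ v, f v = G fun s => v s := by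
  have hf' : DependsOn f (Finset.range k : Set ℕ) := by simpa using hf
  obtain ⟨g, hg⟩ := dependsOn_iff_exists_comp.1 hf'
  exact ⟨g, fun v => congrFun hg v⟩

/-- A function of finitely many inputs factors through a finite discrete space, so no measurability
has to be checked for `σ`, `gMean` or the policy. -/
theorem IsModel.measurable_of_dependsOn {β : Type*} [MeasurableSpace β] [Nonempty β]
    (hM : IsModel P μ W D) {f : (ℕ → Input U C) → β} {k : ℕ} (hf : DependsOn f (Set.Iio k)) :
    Measurable fun ω => f (inputs W D ω) := by
  obtain ⟨G, hG⟩ := hf.exists_comp_restrict_range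
  simp_rw [hG]
  exact (Measurable.of_discrete (f := G)).comp
    (measurable_pi_lambda _ fun s => hM.measurable_inputs s)

theorem IsModel.measurableSet_of_dependsOn (hM : IsModel P μ W D) {A : (ℕ → Input U C) → Prop}
    {k : ℕ} (hA : DependsOn A (Set.Iio k)) : MeasurableSet {ω | A (inputs W D ω)} :=
  measurableSet_setOfPred.2 (hM.measurable_of_dependsOn hA)

theorem dependsOn_update_Iio {α β : Type*} {f : (ℕ → α) → β} {k : ℕ}
    (hf : DependsOn f (Set.Iio (k + 1))) (x : α) :
    DependsOn (fun v => f (Function.update v k x)) (Set.Iio k) := by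
  intro v v' h
  refine hf fun i hi => ?_
  by_cases hik : i = k
  · subst hik; simp
  · have : i < k := lt_of_le_of_ne (Nat.lt_succ_iff.1 hi) hik
    simp [hik, h i this]

/-- The input of slot `k` may be averaged out of any function of the inputs up to slot `k`. -/
theorem IsModel.lintegral_resample [IsProbabilityMeasure P] (hM : IsModel P μ W D) (hμ : ∀ i, μ i ∈ Set.Ioo (0 : ℝ) 1)
    {f : (ℕ → Input U C) → ℝ≥0∞} {k : ℕ} (hf : DependsOn f (Set.Iio (k + 1))) :
    ∫⁻ ω, f (inputs W D ω) ∂P =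
      ∫⁻ ω, ∑ x, inputWeight μ x * f (Function.update (inputs W D ω) k x) ∂P := by
  classical
  have hdep := fun x => dependsOn_update_Iio hf x
  have h1 : ∀ ω, f (inputs W D ω) = ∑ x, f (Function.update (inputs W D ω) k x) *
      (if inputs W D ω k = x then 1 else 0) := by
    intro ω
    simp
  simp_rw [h1]
  rw [lintegral_finsetSum _ fun x _ => ?_, lintegral_finsetSum _ fun x _ => ?_]
  · refine Finset.sum_congr rfl fun x _ => ?_
    obtain ⟨G, hG⟩ := (hdep x).exists_comp_restrict_range
    have hmul := lintegral_mul_eq_lintegral_mul_lintegral_of_indepFun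
      (f := fun ω => G fun s => inputs W D ω s)
      (g := fun ω => if inputs W D ω k = x then (1 : ℝ≥0∞) else 0) (μ := P)
      ((Measurable.of_discrete (f := G)).comp
        (measurable_pi_lambda _ fun s => hM.measurable_inputs s))
      ((Measurable.of_discrete (f := fun y => if y = x then (1 : ℝ≥0∞) else 0)).comp
        (hM.measurable_inputs k))
      ((hM.indepFun_inputs k).comp (φ := G) (ψ := fun y => if y = x then (1 : ℝ≥0∞) else 0)
        Measurable.of_discrete Measurable.of_discrete)
    have hind : ∫⁻ ω, (if inputs W D ω k = x then (1 : ℝ≥0∞) else 0) ∂P = inputWeight μ x := by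
      have hmx : MeasurableSet {ω | inputs W D ω k = x} :=
        hM.measurable_inputs k (MeasurableSet.singleton x)
      rw [← hM.measure_inputs_eq hμ k x, ← lintegral_indicator_one hmx]
      exact lintegral_congr fun ω => by simp [Set.indicator_apply]
    simp_rw [hG]
    rw [lintegral_const_mul, ← hind, mul_comm]
    · exact hmul
    · exact (Measurable.of_discrete (f := G)).comp
        (measurable_pi_lambda _ fun s => hM.measurable_inputs s)
  · exact (hM.measurable_of_dependsOn (hdep x)).const_mul _
  · exact (hM.measurable_of_dependsOn (hdep x)).mul
      ((Measurable.of_discrete (f := fun y => if y = x then (1 : ℝ≥0∞) else 0)).comp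
        (hM.measurable_inputs k))

/-- If some rank draw of slot `k` leads from `A` to `B`, then `B` has at least the probability of
`A` times that of the draw. -/
theorem IsModel.measure_mul_le_of_exists_draw [IsProbabilityMeasure P] (hM : IsModel P μ W D)
    (hμ : ∀ i, μ i ∈ Set.Ioo (0 : ℝ) 1) {A B : (ℕ → Input U C) → Prop} {k : ℕ}
    (hA : DependsOn A (Set.Iio k)) (hB : DependsOn B (Set.Iio (k + 1)))
    (h : ∀ v, A v → ∃ d, ∀ w, B (Function.update v k (w, d))) :
    P {ω | A (inputs W D ω)} * ((U : ℝ≥0∞)⁻¹) ^ U ≤ P {ω | B (inputs W D ω)} := by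
  classical
  have hmA := hM.measurableSet_of_dependsOn hA
  have hmB := hM.measurableSet_of_dependsOn hB
  have hdep : DependsOn (fun v => if B v then (1 : ℝ≥0∞) else 0) (Set.Iio (k + 1)) := by
    intro v v' hv
    simp only [hB hv]
  have eB : P {ω | B (inputs W D ω)} =
      ∫⁻ ω, (fun v => if B v then (1 : ℝ≥0∞) else 0) (inputs W D ω) ∂P := by
    rw [← lintegral_indicator_one hmB]
    exact lintegral_congr fun ω => by simp [Set.indicator_apply]
  rw [eB, hM.lintegral_resample hμ hdep, ← lintegral_indicator_one hmA,
    ← lintegral_mul_const _ (measurable_one.indicator hmA)]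
  refine lintegral_mono fun ω => ?_
  by_cases hω : A (inputs W D ω)
  · obtain ⟨d, hd⟩ := h _ hω
    simp only [Set.indicator_apply, Set.mem_ofPred_eq, hω, if_true, Pi.one_apply, one_mul]
    calc ((U : ℝ≥0∞)⁻¹) ^ U
        = ∑ d', ((U : ℝ≥0∞)⁻¹) ^ U * (if d' = d then 1 else 0) := by simp
      _ = ∑ x : Input U C, inputWeight μ x * (if x.2 = d then 1 else 0) :=
          (sum_inputWeight_mul_snd hμ fun d' => if d' = d then 1 else 0).symm
      _ ≤ _ := by
          refine Finset.sum_le_sum fun x _ => mul_le_mul_right ?_ _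
          split_ifs with h1 h2
          · exact le_rfl
          · refine absurd ?_ h2
            have := hd x.1
            rwa [← h1] at this
          · exact zero_le
          · exact le_rfl
  · simp [hω]

end Model

/-! ### The policy as a function of the sequence of one-slot inputs -/

section Run

variable {U C : ℕ} [NeZero U] (hUC : U ≤ C)
  (σ : (Fin C → ℝ) → Equiv.Perm (Fin C)) (init : Fin U → Equiv.Perm (Fin C))

/-- The state after `k` slots under the inputs `v`. -/
def runState (v : ℕ → Input U C) (k : ℕ) : State U C :=
  stateAfter hUC σ init (fun k => (v k).1) (fun k => (v k).2) k

/-- The rank used by the users in slot `k + 1`. -/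
def runRank (v : ℕ → Input U C) (k : ℕ) : Config U :=
  slotRank (runState hUC σ init v k) (v k).2

/-- The channels sensed by the users in slot `k + 1`. -/
def runChannel (v : ℕ → Input U C) (k : ℕ) : Fin U → Fin C :=
  slotChannel hUC σ init k (runState hUC σ init v k) (v k).2

theorem runState_succ (v : ℕ → Input U C) (k : ℕ) :
    runState hUC σ init v (k + 1) =
      { sensed := fun j i => (runState hUC σ init v k).sensed j i +
          if runChannel hUC σ init v k j = i then 1 else 0
        free := fun j i => (runState hUC σ init v k).free j i +
          if runChannel hUC σ init v k j = i ∧ (v k).1 i = true then 1 else 0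
        rank := runRank hUC σ init v k
        collided := fun j => decide (C ≤ k ∧ Collides (runChannel hUC σ init v k) j) } := rfl

/-- Adaptedness: the state before slot `k + 1` is determined by the inputs with index below `k`. All
later independence arguments rest on this. -/
theorem dependsOn_runState (k : ℕ) :
    DependsOn (fun v => runState hUC σ init v k) (Set.Iio k) := by
  induction k with
  | zero => intro v v' _; rfl
  | succ k ih =>
    intro v v' h
    have h1 := ih fun i hi => h i (Set.mem_Iio.2 (lt_trans (Set.mem_Iio.1 hi) k.lt_succ_self))
    have h2 := h k (Set.mem_Iio.2 k.lt_succ_self)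
    let F : State U C → Input U C → State U C := fun s x =>
      { sensed := fun j i => s.sensed j i + if slotChannel hUC σ init k s x.2 j = i then 1 else 0
        free := fun j i => s.free j i +
          if slotChannel hUC σ init k s x.2 j = i ∧ x.1 i = true then 1 else 0
        rank := slotRank s x.2
        collided := fun j => decide (C ≤ k ∧ Collides (slotChannel hUC σ init k s x.2) j) }
    exact congrArg₂ F h1 h2

theorem dependsOn_runState_prod (k : ℕ) :
    DependsOn (fun v => (runState hUC σ init v k, v k)) (Set.Iio (k + 1)) := by
  intro v v' h
  exact Prod.ext (dependsOn_runState hUC σ init k fun i hi =>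
    h i (Set.mem_Iio.2 (lt_trans (Set.mem_Iio.1 hi) k.lt_succ_self)))
    (h k (Set.mem_Iio.2 k.lt_succ_self))

theorem dependsOn_of_runState {β : Type*} {k m : ℕ} (hkm : k ≤ m) (F : State U C → β) :
    DependsOn (fun v => F (runState hUC σ init v k)) (Set.Iio m) := fun _ _ h =>
  congrArg F (dependsOn_runState hUC σ init k fun i hi =>
    h i (Set.mem_Iio.2 (lt_of_lt_of_le (Set.mem_Iio.1 hi) hkm)))

theorem dependsOn_of_runState_prod {β : Type*} {k m : ℕ} (hkm : k < m)
    (F : State U C → Input U C → β) :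
    DependsOn (fun v => F (runState hUC σ init v k) (v k)) (Set.Iio m) := fun _ _ h =>
  congrArg (fun p : State U C × Input U C => F p.1 p.2)
    (dependsOn_runState_prod hUC σ init k fun i hi =>
      h i (Set.mem_Iio.2 (lt_of_lt_of_le (Set.mem_Iio.1 hi) hkm)))

theorem runState_update (v : ℕ → Input U C) {k m : ℕ} (hkm : k ≤ m) (x : Input U C) :
    runState hUC σ init (Function.update v m x) k = runState hUC σ init v k := by
  refine dependsOn_runState hUC σ init k fun i hi => ?_
  rw [Function.update_of_ne]
  have := Set.mem_Iio.1 hi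
  omega

theorem runRank_update_self (v : ℕ → Input U C) (k : ℕ) (x : Input U C) :
    runRank hUC σ init (Function.update v k x) k = slotRank (runState hUC σ init v k) x.2 := by
  rw [runRank, runState_update hUC σ init v le_rfl, Function.update_self]

theorem runChannel_update_self (v : ℕ → Input U C) (k : ℕ) (x : Input U C) :
    runChannel hUC σ init (Function.update v k x) k =
      slotChannel hUC σ init k (runState hUC σ init v k) x.2 := by
  rw [runChannel, runState_update hUC σ init v le_rfl, Function.update_self]

theorem runChannel_eq (v : ℕ → Input U C) {k : ℕ} (hk : C ≤ k) (j : Fin U) :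
    runChannel hUC σ init v k j =
      σ (gMean (runState hUC σ init v k) k j) (Fin.castLE hUC (runRank hUC σ init v k j)) := by
  simp [runChannel, slotChannel, hk.not_gt, runRank]

theorem sum_sensed (v : ℕ → Input U C) (k : ℕ) (j : Fin U) :
    ∑ i, (runState hUC σ init v k).sensed j i = k := by
  induction k with
  | zero => simp [runState, stateAfter]
  | succ k ih => simp [runState_succ, Finset.sum_add_distrib, ih]

theorem sensed_le (v : ℕ → Input U C) (k : ℕ) (j : Fin U) (i : Fin C) :
    (runState hUC σ init v k).sensed j i ≤ k := by
  conv_rhs => rw [← sum_sensed hUC σ init v k j]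
  exact Finset.single_le_sum (f := fun i => (runState hUC σ init v k).sensed j i)
    (fun _ _ => Nat.zero_le _) (Finset.mem_univ i)

theorem le_of_forall_sensed_pos (v : ℕ → Input U C) {k : ℕ} {j : Fin U}
    (h : ∀ i, 0 < (runState hUC σ init v k).sensed j i) : C ≤ k := by
  calc C = ∑ _i : Fin C, 1 := by simp
    _ ≤ ∑ i, (runState hUC σ init v k).sensed j i := Finset.sum_le_sum fun i _ => h i
    _ = k := sum_sensed hUC σ init v k j

theorem sensed_mono (v : ℕ → Input U C) (j : Fin U) (i : Fin C) :
    Monotone fun k => (runState hUC σ init v k).sensed j i :=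
  monotone_nat_of_le_succ fun k => by simp [runState_succ]

theorem sensed_pos (v : ℕ → Input U C) {k : ℕ} (hk : C ≤ k) (j : Fin U) (i : Fin C) :
    0 < (runState hUC σ init v k).sensed j i := by
  have h1 : runChannel hUC σ init v ((init j).symm i : ℕ) j = i := by
    simp [runChannel, slotChannel]
  have h2 : 0 < (runState hUC σ init v (((init j).symm i : ℕ) + 1)).sensed j i := by
    simp [runState_succ, h1]
  refine h2.trans_le (sensed_mono hUC σ init v j i ?_)
  have := ((init j).symm i).2
  omega

/-- All users have the correct top ranks at the beginning of slot `k + 1`. -/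
def AllCorrect (μ : Fin C → ℝ) (v : ℕ → Input U C) (k : ℕ) : Prop :=
  ∀ j, RanksCorrect hUC σ μ k (runState hUC σ init v k) j

variable {hUC σ init} {μ : Fin C → ℝ} {v : ℕ → Input U C} {k : ℕ}

theorem AllCorrect.le (h : AllCorrect hUC σ init μ v k) : C ≤ k :=
  le_of_forall_sensed_pos hUC σ init v (h 0).1

theorem AllCorrect.runChannel_eq (h : AllCorrect hUC σ init μ v k) (j : Fin U) :
    runChannel hUC σ init v k j = σ μ (Fin.castLE hUC (runRank hUC σ init v k j)) := by
  rw [RhoRand.runChannel_eq hUC σ init v h.le]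
  exact (h j).2 _

/-- With correct ranks all users apply the same injective map from ranks to channels. -/
theorem AllCorrect.collides_iff (h : AllCorrect hUC σ init μ v k) (j : Fin U) :
    Collides (runChannel hUC σ init v k) j ↔ ¬ IsLone (runRank hUC σ init v k) j := by
  simp only [Collides, IsLone, h.runChannel_eq, (σ μ).injective.eq_iff,
    (Fin.castLE_injective hUC).eq_iff]
  push Not
  rfl

/-- The configuration after the users that are not alone have redrawn. -/
def redraw (x : Config U) (d : Fin U → Fin U) : Config U :=
  fun j => if IsLone x j then x j else d j

/-- This couples the policy to the chain. Correctness forces `C ≤ k`, so the collisions of this slot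
are recorded and trigger redraws. -/
theorem AllCorrect.runRank_succ (h : AllCorrect hUC σ init μ v k) :
    runRank hUC σ init v (k + 1) = redraw (runRank hUC σ init v k) (v (k + 1)).2 := by
  funext j
  rw [runRank, slotRank, runState_succ]
  simp only [h.le, true_and, h.collides_iff, redraw, decide_not, Bool.not_eq_true',
    decide_eq_false_iff_not]
  split_ifs <;> rfl

end Run

/-- The draws of lone users are ignored, so every successor arises from the same number `K` of draw
vectors; the image of the uniform law is thus uniform on the successors. -/
theorem sum_redraw {U : ℕ} [NeZero U] (x : Config U) (f : Config U → ℝ≥0∞) :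
    ∑ d, ((U : ℝ≥0∞)⁻¹) ^ U * f (redraw x d) = ∑ y, step x y * f y := by
  classical
  have hmaps : ∀ d ∈ (Finset.univ : Finset (Fin U → Fin U)), redraw x d ∈ successors x := by
    intro d _
    simp only [successors, Finset.mem_filter, Finset.mem_univ, true_and]
    intro j hj
    simp [redraw, hj]
  let K : ℕ := ∏ j, if IsLone x j then U else 1
  have hfib : ∀ y ∈ successors x,
      (Finset.univ.filter fun d : Fin U → Fin U => redraw x d = y).card = K := by
    intro y hy
    have hy' : ∀ j, IsLone x j → y j = x j := by simpa [successors] using hy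
    have : (Finset.univ.filter fun d : Fin U → Fin U => redraw x d = y) =
        Fintype.piFinset fun j => if IsLone x j then Finset.univ else {y j} := by
      ext d
      simp only [Finset.mem_filter, Finset.mem_univ, true_and, Fintype.mem_piFinset, funext_iff,
        redraw]
      refine forall_congr' fun j => ?_
      by_cases hj : IsLone x j
      · simp [hj, hy' j hj]
      · simp [hj]
    rw [this, Fintype.card_piFinset]
    refine Finset.prod_congr rfl fun j _ => ?_
    split_ifs <;> simp
  have hsum : ∀ g : Config U → ℝ≥0∞, ∑ d, ((U : ℝ≥0∞)⁻¹) ^ U * g (redraw x d) =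
      ∑ y ∈ successors x, (K * ((U : ℝ≥0∞)⁻¹) ^ U) * g y := by
    intro g
    rw [← Finset.sum_fiberwise_of_maps_to hmaps]
    refine Finset.sum_congr rfl fun y hy => ?_
    rw [Finset.sum_congr rfl (g := fun _ => ((U : ℝ≥0∞)⁻¹) ^ U * g y), Finset.sum_const, hfib y hy,
      nsmul_eq_mul, mul_assoc]
    intro d hd
    rw [(Finset.mem_filter.1 hd).2]
  -- The normalization follows by testing with the constant function one, without counting the
  -- successors.
  have hK : (K * ((U : ℝ≥0∞)⁻¹) ^ U) = ((successors x).card : ℝ≥0∞)⁻¹ := by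
    have h1 := hsum fun _ => 1
    simp only [mul_one] at h1
    rw [sum_uniformWeight, Finset.sum_const, nsmul_eq_mul] at h1
    refine ENNReal.eq_inv_of_mul_eq_one_left ?_
    rw [mul_comm]
    exact h1.symm
  rw [hsum, hK, ← Finset.sum_subset (Finset.subset_univ (successors x))]
  · exact Finset.sum_congr rfl fun y hy => by rw [step_apply_of_mem hy]
  · intro y _ hy
    rw [step, PMF.uniformOfFinset_apply_of_notMem _ hy, zero_mul]

/-! ### Collisions are controlled by the slots with wrong ranks -/

section FirstBound

variable {Ω : Type*} [MeasurableSpace Ω] {P : Measure Ω} {U C : ℕ} [NeZero U] {hUC : U ≤ C}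
  {σ : (Fin C → ℝ) → Equiv.Perm (Fin C)} {init : Fin U → Equiv.Perm (Fin C)}
  {μ : Fin C → ℝ} {W : ℕ → Fin C → Ω → Bool} {D : ℕ → Fin U → Ω → Fin U}

theorem dependsOn_allCorrect {k m : ℕ} (hkm : k ≤ m) :
    DependsOn (fun v => AllCorrect hUC σ init μ v k) (Set.Iio m) :=
  dependsOn_of_runState hUC σ init hkm fun s => ∀ j, RanksCorrect hUC σ μ k s j

open Classical in
theorem dependsOn_ite_allCorrect {k m : ℕ} (hkm : k ≤ m) {β : Type*} {f g : (ℕ → Input U C) → β}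
    (hf : DependsOn f (Set.Iio m)) (hg : DependsOn g (Set.Iio m)) :
    DependsOn (fun v => if AllCorrect hUC σ init μ v k then f v else g v) (Set.Iio m) := by
  intro v v' h
  have h1 := dependsOn_allCorrect (hUC := hUC) (σ := σ) (init := init) (μ := μ) hkm h
  simp only at h1 ⊢
  rw [hf h, hg h]
  simp only [h1]

theorem dependsOn_runRank {β : Type*} {k m : ℕ} (hkm : k < m) (F : Config U → β) :
    DependsOn (fun v => F (runRank hUC σ init v k)) (Set.Iio m) :=
  dependsOn_of_runState_prod hUC σ init hkm fun s x => F (slotRank s x.2)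

open Classical in
/-- One step of the absorption-time potential along slots with correct ranks. -/
theorem IsModel.lintegral_meanAbsorption_succ [IsProbabilityMeasure P] (hM : IsModel P μ W D)
    (hμ : ∀ i, μ i ∈ Set.Ioo (0 : ℝ) 1) (k : ℕ) :
    ∫⁻ ω, (if AllCorrect hUC σ init μ (inputs W D ω) k then
        (if Function.Injective (runRank hUC σ init (inputs W D ω) k) then 0 else 1) else 0) ∂P +
      ∫⁻ ω, (if AllCorrect hUC σ init μ (inputs W D ω) k then
        meanAbsorption (runRank hUC σ init (inputs W D ω) (k + 1)) else 0) ∂P =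
    ∫⁻ ω, (if AllCorrect hUC σ init μ (inputs W D ω) k then
        meanAbsorption (runRank hUC σ init (inputs W D ω) k) else 0) ∂P := by
  have hdep : DependsOn (fun v : ℕ → Input U C => if AllCorrect hUC σ init μ v k then
      meanAbsorption (runRank hUC σ init v (k + 1)) else 0) (Set.Iio (k + 1 + 1)) :=
    dependsOn_ite_allCorrect (by omega) (dependsOn_runRank (by omega) meanAbsorption)
      (fun _ _ _ => rfl)
  rw [hM.lintegral_resample hμ hdep, ← lintegral_add_left]
  · refine lintegral_congr fun ω => ?_
    set v := inputs W D ω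
    have hcor : ∀ x, AllCorrect hUC σ init μ (Function.update v (k + 1) x) k ↔
        AllCorrect hUC σ init μ v k := by
      intro x
      simp only [AllCorrect, runState_update hUC σ init v (Nat.le_succ k)]
    simp only [hcor]
    by_cases h : AllCorrect hUC σ init μ v k
    · simp only [h, if_true]
      rw [meanAbsorption_eq (runRank hUC σ init v k), ← sum_redraw,
        ← sum_inputWeight_mul_snd hμ fun d => meanAbsorption (redraw (runRank hUC σ init v k) d)]
      refine congrArg₂ _ rfl (Finset.sum_congr rfl fun x _ => ?_)
      rw [((hcor x).2 h).runRank_succ, Function.update_self]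
      congr 3
      rw [runRank, runRank, runState_update hUC σ init v (Nat.le_succ k),
        Function.update_of_ne (by omega)]
    · simp [h]
  · exact hM.measurable_of_dependsOn (k := k + 1) (f := fun v => if AllCorrect hUC σ init μ v k then
      (if Function.Injective (runRank hUC σ init v k) then (0 : ℝ≥0∞) else 1) else 0)
      (dependsOn_ite_allCorrect (by omega)
        (dependsOn_runRank (by omega) fun x => if Function.Injective x then (0 : ℝ≥0∞) else 1)
        (fun _ _ _ => rfl))

open Classical in
-- Telescoping of the potential `meanAbsorption`, with the current potential kept on the left as
-- induction invariant. The base case uses that slot `0` is never correct, because `C > 0`.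
theorem IsModel.sum_lintegral_not_injective_le [IsProbabilityMeasure P] (hM : IsModel P μ W D)
    (hμ : ∀ i, μ i ∈ Set.Ioo (0 : ℝ) 1) (n : ℕ) :
    ∑ k ∈ Finset.range n, ∫⁻ ω, (if AllCorrect hUC σ init μ (inputs W D ω) k then
        (if Function.Injective (runRank hUC σ init (inputs W D ω) k) then 0 else 1) else 0) ∂P +
      ∫⁻ ω, (if AllCorrect hUC σ init μ (inputs W D ω) n then
        meanAbsorption (runRank hUC σ init (inputs W D ω) n) else 0) ∂P ≤
    ∑ k ∈ Finset.range n, expectedUpsilon U *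
      ∫⁻ ω, (if AllCorrect hUC σ init μ (inputs W D ω) k then 0 else 1) ∂P := by
  induction n with
  | zero =>
    have hC : 0 < C := (NeZero.pos U).trans_le hUC
    have : ∀ ω, ¬ AllCorrect hUC σ init μ (inputs W D ω) 0 := fun ω h => by
      have := h.le
      omega
    simp [this]
  | succ n ih =>
    have hmeas : Measurable fun ω => if AllCorrect hUC σ init μ (inputs W D ω) n then
        (0 : ℝ≥0∞) else 1 :=
      hM.measurable_of_dependsOn (k := n) (f := fun v => if AllCorrect hUC σ init μ v n then
        (0 : ℝ≥0∞) else 1)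
        (dependsOn_ite_allCorrect le_rfl (fun _ _ _ => rfl) (fun _ _ _ => rfl))
    rw [Finset.sum_range_succ, Finset.sum_range_succ]
    refine le_trans ?_ (add_le_add ih le_rfl)
    rw [add_assoc, add_assoc]
    refine add_le_add le_rfl ?_
    rw [← hM.lintegral_meanAbsorption_succ hμ n, add_assoc]
    refine add_le_add le_rfl ?_
    rw [← lintegral_const_mul _ hmeas, ← lintegral_add_right _ (hmeas.const_mul _)]
    refine lintegral_mono fun ω => ?_
    -- After a correct slot the new potential is already accounted for; after a wrong one it is paid
    -- by `expectedUpsilon U`.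
    by_cases h1 : AllCorrect hUC σ init μ (inputs W D ω) n <;>
      by_cases h2 : AllCorrect hUC σ init μ (inputs W D ω) (n + 1) <;>
      simp [h1, h2, meanAbsorption_le_expectedUpsilon]

theorem wrongSlots_eq_sum [∀ v k, Decidable (AllCorrect hUC σ init μ v k)] (v : ℕ → Input U C)
    (n : ℕ) :
    (wrongSlots hUC σ init μ (fun k => (v k).1) (fun k => (v k).2) n : ℝ≥0∞) =
      ∑ k ∈ Finset.range n, if AllCorrect hUC σ init μ v k then 0 else 1 := by
  rw [wrongSlots, Finset.card_filter]
  push_cast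
  refine Finset.sum_congr rfl fun k _ => ?_
  by_cases h : AllCorrect hUC σ init μ v k
  · have : ¬ ∃ j, ¬ RanksCorrect hUC σ μ k (runState hUC σ init v k) j := by
      push Not; exact h
    simp only [h, if_true]
    exact if_neg this
  · have h' : ∃ j, ¬ RanksCorrect hUC σ μ k (runState hUC σ init v k) j := by
      unfold AllCorrect at h
      push Not at h; exact h
    simp only [h, if_false]
    exact if_pos h'

theorem collisions_le_sum (v : ℕ → Input U C) (n : ℕ) (f : ℕ → ℝ≥0∞)
    (hf : ∀ k < n, (∃ j, Collides (runChannel hUC σ init v k) j) → 1 ≤ f k) :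
    (collisions hUC σ init μ (fun k => (v k).1) (fun k => (v k).2) n : ℝ≥0∞) ≤
      U * ∑ k ∈ Finset.range n, f k := by
  rw [collisions, Nat.cast_sum, Finset.mul_sum]
  refine Finset.sum_le_sum fun k hk => ?_
  by_cases h : ∃ j, Collides (runChannel hUC σ init v k) j
  · calc (((Finset.univ.filter _).card : ℕ) : ℝ≥0∞) ≤ ((Finset.univ : Finset (Fin U)).card : ℕ) := by
          exact_mod_cast Finset.card_le_card (Finset.filter_subset _ _)
      _ = U * 1 := by simp
      _ ≤ U * f k := mul_le_mul_right (hf k (Finset.mem_range.1 hk) h) _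
  · push Not at h
    rw [Finset.card_eq_zero.2]
    · simp
    · exact Finset.filter_eq_empty_iff.2 fun j _ hj => h j hj.2

/-- The expected number of collisions is at most a constant times the expected number of slots in
which the top ranks are not correct everywhere. -/
theorem IsModel.lintegral_collisions_le [IsProbabilityMeasure P] (hM : IsModel P μ W D)
    (hμ : ∀ i, μ i ∈ Set.Ioo (0 : ℝ) 1) (n : ℕ) :
    ∫⁻ ω, (collisions hUC σ init μ (fun k i => W k i ω) (fun k j => D k j ω) n : ℝ≥0∞) ∂P ≤
      U * (expectedUpsilon U + 1) *
        ∫⁻ ω, (wrongSlots hUC σ init μ (fun k i => W k i ω) (fun k j => D k j ω) n : ℝ≥0∞) ∂P := by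
  classical
  have hm1 : ∀ k, Measurable fun ω => if AllCorrect hUC σ init μ (inputs W D ω) k then
      (if Function.Injective (runRank hUC σ init (inputs W D ω) k) then (0 : ℝ≥0∞) else 1) else 0 :=
    fun k => hM.measurable_of_dependsOn (k := k + 1)
      (f := fun v => if AllCorrect hUC σ init μ v k then
        (if Function.Injective (runRank hUC σ init v k) then (0 : ℝ≥0∞) else 1) else 0)
      (dependsOn_ite_allCorrect (by omega)
        (dependsOn_runRank (by omega) fun x => if Function.Injective x then (0 : ℝ≥0∞) else 1)
        (fun _ _ _ => rfl))
  have hm2 : ∀ k, Measurable fun ω => if AllCorrect hUC σ init μ (inputs W D ω) k then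
      (0 : ℝ≥0∞) else 1 := fun k =>
    hM.measurable_of_dependsOn (k := k) (f := fun v => if AllCorrect hUC σ init μ v k then
      (0 : ℝ≥0∞) else 1)
      (dependsOn_ite_allCorrect le_rfl (fun _ _ _ => rfl) (fun _ _ _ => rfl))
  have hm3 : ∀ k, Measurable fun ω => (if AllCorrect hUC σ init μ (inputs W D ω) k then
      (if Function.Injective (runRank hUC σ init (inputs W D ω) k) then (0 : ℝ≥0∞) else 1) else 0) +
      (if AllCorrect hUC σ init μ (inputs W D ω) k then (0 : ℝ≥0∞) else 1) :=
    fun k => (hm1 k).add (hm2 k)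
  have hT : ∫⁻ ω, (wrongSlots hUC σ init μ (fun k i => W k i ω) (fun k j => D k j ω) n : ℝ≥0∞) ∂P =
      ∑ k ∈ Finset.range n,
        ∫⁻ ω, (if AllCorrect hUC σ init μ (inputs W D ω) k then 0 else 1) ∂P := by
    rw [← lintegral_finsetSum _ fun k _ => hm2 k]
    exact lintegral_congr fun ω => wrongSlots_eq_sum (inputs W D ω) n
  calc ∫⁻ ω, (collisions hUC σ init μ (fun k i => W k i ω) (fun k j => D k j ω) n : ℝ≥0∞) ∂P
      ≤ ∫⁻ ω, U * ∑ k ∈ Finset.range n,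
        ((if AllCorrect hUC σ init μ (inputs W D ω) k then
          (if Function.Injective (runRank hUC σ init (inputs W D ω) k) then 0 else 1) else 0) +
          (if AllCorrect hUC σ init μ (inputs W D ω) k then 0 else 1)) ∂P := by
        refine lintegral_mono fun ω => collisions_le_sum (inputs W D ω) n _ fun k _ hk => ?_
        by_cases h : AllCorrect hUC σ init μ (inputs W D ω) k
        · obtain ⟨j, hj⟩ := hk
          have : ¬ Function.Injective (runRank hUC σ init (inputs W D ω) k) := fun hinj =>
            (h.collides_iff j).1 hj (isLone_of_injective hinj j)
          simp [h, this]
        · simp [h]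
    _ = U * (∑ k ∈ Finset.range n, ∫⁻ ω, (if AllCorrect hUC σ init μ (inputs W D ω) k then
          (if Function.Injective (runRank hUC σ init (inputs W D ω) k) then 0 else 1) else 0) ∂P +
        ∑ k ∈ Finset.range n,
          ∫⁻ ω, (if AllCorrect hUC σ init μ (inputs W D ω) k then 0 else 1) ∂P) := by
        rw [lintegral_const_mul _ (Finset.measurable_fun_sum _ fun k _ => hm3 k),
          lintegral_finsetSum _ fun k _ => hm3 k, ← Finset.sum_add_distrib]
        congr 1
        exact Finset.sum_congr rfl fun k _ => lintegral_add_left (hm1 k) _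
    _ ≤ U * (expectedUpsilon U * ∑ k ∈ Finset.range n,
          ∫⁻ ω, (if AllCorrect hUC σ init μ (inputs W D ω) k then 0 else 1) ∂P +
        ∑ k ∈ Finset.range n,
          ∫⁻ ω, (if AllCorrect hUC σ init μ (inputs W D ω) k then 0 else 1) ∂P) := by
        refine mul_le_mul_right (add_le_add ?_ le_rfl) _
        rw [Finset.mul_sum]
        exact le_trans le_self_add (hM.sum_lintegral_not_injective_le hμ n)
    _ = _ := by
        rw [hT]
        ring

end FirstBound

/-! ### Rankings of perturbed vectors -/

section Ranking

variable {C : ℕ} {g g' μ : Fin C → ℝ} {π π' τ : Equiv.Perm (Fin C)}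

theorem le_of_symm_le (hπ : Antitone (g ∘ π)) {i i' : Fin C} (h : π.symm i ≤ π.symm i') :
    g i' ≤ g i := by
  simpa using hπ h

theorem symm_lt_of_lt (hπ : Antitone (g ∘ π)) {i i' : Fin C} (h : g i' < g i) :
    π.symm i < π.symm i' := by
  by_contra hn
  exact (le_of_symm_le hπ (not_lt.1 hn)).not_gt h

theorem card_symm_lt (π : Equiv.Perm (Fin C)) (p : Fin C) :
    (Finset.univ.filter fun i => π.symm i < p).card = p := by
  have : (Finset.univ.filter fun i => π.symm i < p) = (Finset.Iio p).map π.toEmbedding := by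
    ext i
    simp [Finset.mem_map_equiv]
  rw [this, Finset.card_map, Fin.card_Iio]

theorem le_of_forall_symm_lt {p q : Fin C} (h : ∀ i, τ.symm i < q → π.symm i < p) : q ≤ p := by
  have := Finset.card_le_card (Finset.monotone_filter_right Finset.univ
    (p := fun i => τ.symm i < q) (q := fun i => π.symm i < p) (fun i _ => h i))
  rw [card_symm_lt, card_symm_lt] at this
  exact this

/-- If an entry leaves the top positions, then another one enters them. -/
theorem exists_symm_lt_of_exists {m : ℕ} {x : Fin C} (hx : (π.symm x : ℕ) < m)
    (hx' : ¬ (π'.symm x : ℕ) < m) :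
    ∃ y, (π'.symm y : ℕ) < m ∧ ¬ (π.symm y : ℕ) < m := by
  by_contra! hcon
  have hcard : ∀ ρ : Equiv.Perm (Fin C), (Finset.univ.filter fun i => (ρ.symm i : ℕ) < m).card =
      (Finset.univ.filter fun i : Fin C => (i : ℕ) < m).card := by
    intro ρ
    refine Finset.card_bij (fun i _ => ρ.symm i) (fun i hi => by simpa using hi)
      (fun _ _ _ _ h => ρ.symm.injective h) (fun i hi => ⟨ρ i, by simpa using hi, by simp⟩)
  have hsub : (Finset.univ.filter fun i => (π'.symm i : ℕ) < m) ⊆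
      Finset.univ.filter fun i => (π.symm i : ℕ) < m := by
    intro i hi
    simp only [Finset.mem_filter, Finset.mem_univ, true_and] at hi ⊢
    exact hcon i hi
  have heq := Finset.eq_of_subset_of_card_le hsub (by rw [hcard π, hcard π'])
  have : x ∈ Finset.univ.filter fun i => (π'.symm i : ℕ) < m := by
    rw [heq]; simpa using hx
  exact hx' (by simpa using this)

variable {δ : ℝ}

/-- A channel with an accurate index is not ranked above its true rank. -/
theorem true_rank_le (hδ : 0 < δ) (hsep : ∀ i i', μ i < μ i' → μ i + δ ≤ μ i')
    (hμ : Function.Injective μ) (hπ : Antitone (g ∘ π)) (hτ : Antitone (μ ∘ τ))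
    (hlow : ∀ i, μ i ≤ g i) {p : Fin C} (hup : g (π p) ≤ μ (π p) + δ / 2) :
    τ.symm (π p) ≤ p := by
  refine le_of_forall_symm_lt (π := π) (τ := τ) fun i hi => ?_
  have h1 : μ (π p) < μ i := lt_of_le_of_ne (le_of_symm_le hτ hi.le) fun h => by
    rw [hμ h] at hi; exact lt_irrefl _ hi
  -- A truly better channel has index at least `μ (π p) + δ`, which beats the accurate index of `π
  -- p`. So all truly better channels are ranked ahead, and counting concludes.
  have h2 : π.symm i < π.symm (π p) :=
    symm_lt_of_lt hπ (by linarith [hsep _ _ h1, hlow i])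
  simpa using h2

/-- If the top `m` channels have accurate indices, then they are ranked correctly. -/
theorem ranking_eq_of_accurate (hδ : 0 < δ) (hsep : ∀ i i', μ i < μ i' → μ i + δ ≤ μ i')
    (hμ : Function.Injective μ) (hπ : Antitone (g ∘ π)) (hτ : Antitone (μ ∘ τ))
    (hlow : ∀ i, μ i ≤ g i) {m : ℕ}
    (hup : ∀ p : Fin C, (p : ℕ) < m → g (π p) ≤ μ (π p) + δ / 2) {p : Fin C} (hp : (p : ℕ) < m) :
    π p = τ p := by
  have h1 := true_rank_le hδ hsep hμ hπ hτ hlow (hup p hp)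
  have h2 : p ≤ τ.symm (π p) := by
    refine le_of_forall_symm_lt (π := τ) (τ := π) fun i hi => ?_
    refine symm_lt_of_lt hτ ?_
    have hne : i ≠ π p := by
      rintro rfl
      simp at hi
    have hle : g (π p) ≤ g i := le_of_symm_le hπ (by simpa using hi.le)
    by_contra hcon
    -- A channel that is truly worse but accurate has index at most `μ i + δ / 2`, too small to be
    -- ranked ahead of `π p`.
    have hlt : μ i < μ (π p) := lt_of_le_of_ne (not_lt.1 hcon) fun h => hne (hμ h)
    have hi' := hup (π.symm i) (lt_trans (Fin.lt_def.1 hi) hp)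
    rw [Equiv.apply_symm_apply] at hi'
    linarith [hsep _ _ hlt, hlow (π p)]
  have h3 := le_antisymm h1 h2
  rw [← h3, Equiv.apply_symm_apply, h3]

/-- The channel at a fixed position does not change when only its own index moves, as long as the
indices at this position are accurate and the other indices grow slowly. -/
theorem ranking_apply_eq (hδ : 0 < δ) (hsep : ∀ i i', μ i < μ i' → μ i + δ ≤ μ i')
    (hμ : Function.Injective μ) (hπ : Antitone (g ∘ π)) (hπ' : Antitone (g' ∘ π'))
    (hlow : ∀ i, μ i ≤ g i) (hlow' : ∀ i, μ i ≤ g' i) {p : Fin C}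
    (hup : g (π p) ≤ μ (π p) + δ / 2) (hup₁ : g' (π p) ≤ μ (π p) + δ / 2)
    (hup' : g' (π' p) ≤ μ (π' p) + δ / 2)
    (hmono : ∀ i, i ≠ π p → g i ≤ g' i) (hgrow : ∀ i, i ≠ π p → g' i < g i + δ / 2) :
    π' p = π p := by
  by_contra hne
  rcases lt_or_gt_of_ne (fun h => hne (hμ h) : μ (π' p) ≠ μ (π p)) with h | h
  · have h1 : π'.symm (π p) < π'.symm (π' p) :=
      symm_lt_of_lt hπ' (by linarith [hsep _ _ h, hlow' (π p)])
    rw [Equiv.symm_apply_apply] at h1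
    -- The better channel `π p` has moved ahead of position `p`, so some `y` was pushed out. Its old
    -- index was at least `μ (π p)`, its new one is at most that of the worse channel `π' p`, yet
    -- unsensed indices do not decrease.
    obtain ⟨y, hy, hy'⟩ := exists_symm_lt_of_exists (π := π') (π' := π) (m := p)
      (x := π p) h1 (by simp)
    have hy1 : g (π p) ≤ g y := le_of_symm_le hπ (by simpa using (Fin.lt_def.2 hy).le)
    have hy2 : g' y ≤ g' (π' p) := le_of_symm_le hπ' (by simpa using hy')
    have hya : y ≠ π p := by
      rintro rfl
      simp at hy
    linarith [hmono y hya, hlow (π p), hsep _ _ h]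
  · have h1 : π.symm (π' p) < π.symm (π p) :=
      symm_lt_of_lt hπ (by linarith [hsep _ _ h, hlow (π' p)])
    rw [Equiv.symm_apply_apply] at h1
    -- Here the better channel `π' p` has dropped back to position `p`, so some `y` came in ahead of
    -- it. Its index would have to climb from at most `μ (π p) + δ / 2` to at least `μ (π' p)`,
    -- which is a growth of at least `δ / 2`.
    obtain ⟨y, hy, hy'⟩ := exists_symm_lt_of_exists (π := π) (π' := π') (m := p)
      (x := π' p) h1 (by simp)
    have hy1 : g' (π' p) ≤ g' y := le_of_symm_le hπ' (by simpa using (Fin.lt_def.2 hy).le)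
    have hy2 : g y ≤ g (π p) := le_of_symm_le hπ (by simpa using hy')
    have hya : y ≠ π p := by
      rintro rfl
      linarith [hlow' (π' p), hsep _ _ h]
    linarith [hgrow y hya, hlow' (π' p), hsep _ _ h]

end Ranking

/-! ### Growth of the exploration term -/

theorem sqrt_two_log_div {T : ℝ} (hT : 0 ≤ T) (k : ℕ) :
    √(2 * Real.log k / T) = √(2 * Real.log k) / √T := Real.sqrt_div' _ hT

theorem sqrt_two_log_lt {k : ℕ} (hk : 1 ≤ k) :
    √(2 * Real.log k) < √(2 * Real.log (k + 1 : ℕ)) := by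
  have hk' : (1 : ℝ) ≤ k := by exact_mod_cast hk
  refine Real.sqrt_lt_sqrt (by have := Real.log_nonneg hk'; linarith) ?_
  have : Real.log k < Real.log (k + 1 : ℕ) := Real.log_lt_log (by linarith) (by push_cast; linarith)
  linarith

/-- The increment of `2 * log k` is at most `2 / k`, which is eventually below `δ ^ 2`; the cross
term in `(√(2 * log k) + δ) ^ 2` is nonnegative. -/
theorem exists_sqrt_two_log_growth {δ : ℝ} (hδ : 0 < δ) :
    ∃ k₀ : ℕ, ∀ k ≥ k₀, √(2 * Real.log (k + 1 : ℕ)) < √(2 * Real.log k) + δ := by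
  obtain ⟨k₀, hk₀⟩ := exists_nat_gt (2 / δ ^ 2)
  refine ⟨k₀ + 1, fun k hk => ?_⟩
  have hk1 : (1 : ℝ) ≤ k := by exact_mod_cast (by omega : 1 ≤ k)
  have hkk : 2 / δ ^ 2 < k := hk₀.trans_le (by exact_mod_cast (by omega : k₀ ≤ k))
  have hlog : Real.log (k + 1 : ℕ) ≤ Real.log k + 1 / k := by
    have h1 : Real.log (k + 1 : ℕ) - Real.log k = Real.log (1 + 1 / k) := by
      rw [← Real.log_div (by positivity) (by positivity)]
      congr 1
      push_cast
      field_simp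
    have h2 := Real.log_le_sub_one_of_pos (x := 1 + 1 / (k : ℝ)) (by positivity)
    linarith
  have hl := Real.log_nonneg hk1
  have h3 : 2 / (k : ℝ) < δ ^ 2 := by
    rw [div_lt_iff₀ (by positivity)] at hkk ⊢
    linarith
  rw [Real.sqrt_lt' (by positivity), add_sq, Real.sq_sqrt (by positivity)]
  have : 0 ≤ 2 * √(2 * Real.log k) * δ := by positivity
  have h4 : 2 * (1 / (k : ℝ)) = 2 / k := by ring
  linarith

/-! ### Slots with reliable estimates -/

/-- Constants for the analysis of the slots `k ≤ N`: a lower bound `δ` on the gaps of `μ`, a number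
`k₀` of slots after which the exploration terms grow slowly, and a number `L` of samples that
suffices for accurate indices. -/
structure Thresholds {C : ℕ} (μ : Fin C → ℝ) (δ : ℝ) (k₀ L N : ℕ) : Prop where
  injective : Function.Injective μ
  pos : 0 < δ
  sep : ∀ i i', μ i < μ i' → μ i + δ ≤ μ i'
  le : C ≤ k₀
  growth : ∀ k ≥ k₀, √(2 * Real.log (k + 1 : ℕ)) < √(2 * Real.log k) + δ / 2
  samples : 32 * Real.log N ≤ δ ^ 2 * L

/-- All indices are upper confidence bounds, and all sample means obey the confidence bound. -/
def Confident {U C : ℕ} (μ : Fin C → ℝ) (k : ℕ) (s : State U C) : Prop :=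
  ∀ j i, μ i ≤ gMean s k j i ∧
    (s.free j i : ℝ) / (s.sensed j i : ℝ) ≤ μ i + √(2 * Real.log (k : ℝ) / (s.sensed j i : ℝ))

/-- The condition `32 * log N ≤ δ ^ 2 * L` makes the confidence radius at most `δ / 4`. It enters
twice, as the error of the sample mean and as the exploration term. -/
theorem gMean_le_of_confident {U C : ℕ} {μ : Fin C → ℝ} {δ : ℝ} {k₀ L N k : ℕ}
    (ht : Thresholds μ δ k₀ L N) {s : State U C} (hs : Confident μ k s) (hk : 1 ≤ k) (hkN : k ≤ N) {j : Fin U} {i : Fin C} (hpos : 0 < s.sensed j i)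
    (hL : L ≤ s.sensed j i) : gMean s k j i ≤ μ i + δ / 2 := by
  have h1 := (hs j i).2
  have hT : (0 : ℝ) < s.sensed j i := by exact_mod_cast hpos
  have hk' : (0 : ℝ) < k := by exact_mod_cast hk
  have hδ := ht.pos
  have h2 : √(2 * Real.log (k : ℝ) / (s.sensed j i : ℝ)) ≤ δ / 4 := by
    refine Real.sqrt_le_iff.2 ⟨by positivity, ?_⟩
    rw [div_le_iff₀ hT]
    have h3 : Real.log k ≤ Real.log N := Real.log_le_log hk' (by exact_mod_cast hkN)
    have h4 : δ ^ 2 * (L : ℝ) ≤ δ ^ 2 * s.sensed j i :=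
      mul_le_mul_of_nonneg_left (by exact_mod_cast hL) (by positivity)
    nlinarith [ht.samples]
  unfold gMean
  linarith

section Slots

variable {U C : ℕ} [NeZero U] (hUC : U ≤ C)
  (σ : (Fin C → ℝ) → Equiv.Perm (Fin C)) (init : Fin U → Equiv.Perm (Fin C)) (μ : Fin C → ℝ)
  (k₀ L : ℕ)

/-- The estimates after `k` slots are reliable. -/
def Reliable (v : ℕ → Input U C) (k : ℕ) : Prop :=
  k₀ ≤ k ∧ Confident μ k (runState hUC σ init v k)

/-- Every user senses a channel that it has sensed at least `L` times before. -/
def Exploits (v : ℕ → Input U C) (k : ℕ) : Prop :=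
  ∀ j, L ≤ (runState hUC σ init v k).sensed j (runChannel hUC σ init v k j)

/-- The estimates are reliable and every user exploits. -/
def Regular (v : ℕ → Input U C) (k : ℕ) : Prop :=
  Reliable hUC σ init μ k₀ v k ∧ Exploits hUC σ init L v k

/-- A regular slot with a collision. -/
def Active (v : ℕ → Input U C) (k : ℕ) : Prop :=
  Regular hUC σ init μ k₀ L v k ∧ ∃ j, Collides (runChannel hUC σ init v k) j

/-- A regular slot without collisions. -/
def Quiet (v : ℕ → Input U C) (k : ℕ) : Prop :=
  Regular hUC σ init μ k₀ L v k ∧ ∀ j, ¬ Collides (runChannel hUC σ init v k) j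

/-- One of the top ranks of user `j` leads to a channel sensed fewer than `L` times. -/
def Inexperienced (v : ℕ → Input U C) (k : ℕ) (j : Fin U) : Prop :=
  ∃ r : Fin U, (runState hUC σ init v k).sensed j
    (σ (gMean (runState hUC σ init v k) k j) (Fin.castLE hUC r)) < L

/-- Some rank draw of the next slot makes it irregular. -/
def Unstable (v : ℕ → Input U C) (k : ℕ) : Prop :=
  ¬ Reliable hUC σ init μ k₀ v k ∨
    ∃ j, (runState hUC σ init v k).collided j = true ∧ Inexperienced hUC σ init L v k j

variable {hUC σ init μ k₀ L} {δ : ℝ} {N k : ℕ} {v : ℕ → Input U C}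

/-- For an unsensed channel only the logarithm moves. The increment decreases with the sample count,
which decides who can overtake whom. -/
theorem gMean_succ_of_ne {j : Fin U} {i : Fin C} (h : i ≠ runChannel hUC σ init v k j) :
    gMean (runState hUC σ init v (k + 1)) (k + 1) j i - gMean (runState hUC σ init v k) k j i =
      (√(2 * Real.log (k + 1 : ℕ)) - √(2 * Real.log k)) /
        √((runState hUC σ init v k).sensed j i) := by
  have hs : (runState hUC σ init v (k + 1)).sensed j i = (runState hUC σ init v k).sensed j i := by
    simp [runState_succ, h.symm]
  have hf : (runState hUC σ init v (k + 1)).free j i = (runState hUC σ init v k).free j i := by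
    simp [runState_succ, h.symm]
  unfold gMean
  rw [hs, hf, sqrt_two_log_div (Nat.cast_nonneg _), sqrt_two_log_div (Nat.cast_nonneg _)]
  ring

theorem one_le_of_thresholds (hUC : U ≤ C) (ht : Thresholds μ δ k₀ L N) (hk : k₀ ≤ k) : 1 ≤ k := by
  have h1 := NeZero.pos U
  have h2 := ht.le
  omega

theorem gMean_le_gMean_succ (hk : 1 ≤ k) {j : Fin U} {i : Fin C}
    (h : i ≠ runChannel hUC σ init v k j) :
    gMean (runState hUC σ init v k) k j i ≤
      gMean (runState hUC σ init v (k + 1)) (k + 1) j i := by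
  rw [← sub_nonneg, gMean_succ_of_ne h]
  exact div_nonneg (sub_nonneg.2 (sqrt_two_log_lt hk).le) (Real.sqrt_nonneg _)

theorem gMean_succ_lt (ht : Thresholds μ δ k₀ L N) (hk : k₀ ≤ k) {j : Fin U} {i : Fin C}
    (h : i ≠ runChannel hUC σ init v k j) :
    gMean (runState hUC σ init v (k + 1)) (k + 1) j i <
      gMean (runState hUC σ init v k) k j i + δ / 2 := by
  rw [← sub_lt_iff_lt_add', gMean_succ_of_ne h]
  have hpos : (1 : ℝ) ≤ (runState hUC σ init v k).sensed j i := by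
    exact_mod_cast sensed_pos hUC σ init v (ht.le.trans hk) j i
  have h0 := sqrt_two_log_lt (one_le_of_thresholds hUC ht hk)
  refine (div_le_self (sub_nonneg.2 h0.le) (Real.one_le_sqrt.2 hpos)).trans_lt ?_
  linarith [ht.growth k hk]

/-- The rank of a user that did not collide is kept. -/
theorem runRank_succ_of_not_collides {j : Fin U} (h : ¬ Collides (runChannel hUC σ init v k) j) :
    runRank hUC σ init v (k + 1) j = runRank hUC σ init v k j := by
  rw [runRank, slotRank, runState_succ]
  simp [h]

/-- In regular slots, a user that did not collide stays on its channel. -/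
theorem Regular.runChannel_succ (ht : Thresholds μ δ k₀ L N) (hσ : IsRankingRule σ)
    (h : Regular hUC σ init μ k₀ L v k) (h' : Regular hUC σ init μ k₀ L v (k + 1))
    (hN : k + 1 ≤ N) {j : Fin U} (hj : ¬ Collides (runChannel hUC σ init v k) j) :
    runChannel hUC σ init v (k + 1) j = runChannel hUC σ init v k j := by
  obtain ⟨⟨hk, hc⟩, he⟩ := h
  obtain ⟨⟨hk', hc'⟩, he'⟩ := h'
  have hCk := ht.le.trans hk
  have h1 := one_le_of_thresholds hUC ht hk
  have hch := runChannel_eq hUC σ init v hCk j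
  have hch' := runChannel_eq hUC σ init v (hCk.trans k.le_succ) j
  rw [runRank_succ_of_not_collides hj] at hch'
  rw [hch', hch]
  have hj1 := he j
  have hj2 := he' j
  rw [hch] at hj1
  rw [hch'] at hj2
  refine ranking_apply_eq ht.pos ht.sep ht.injective (hσ _) (hσ _) (fun i => (hc j i).1)
    (fun i => (hc' j i).1) ?_ ?_ ?_ ?_ ?_
  · exact gMean_le_of_confident ht hc h1 (by omega) (sensed_pos hUC σ init v hCk _ _) hj1
  · exact gMean_le_of_confident ht hc' (by omega) hN
      (sensed_pos hUC σ init v (hCk.trans k.le_succ) _ _)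
      (hj1.trans (sensed_mono hUC σ init v _ _ k.le_succ))
  · exact gMean_le_of_confident ht hc' (by omega) hN
      (sensed_pos hUC σ init v (hCk.trans k.le_succ) _ _) hj2
  · intro i hi
    rw [← hch] at hi
    exact gMean_le_gMean_succ h1 hi
  · intro i hi
    rw [← hch] at hi
    exact gMean_succ_lt ht hk hi

theorem Quiet.succ (ht : Thresholds μ δ k₀ L N) (hσ : IsRankingRule σ)
    (h : Quiet hUC σ init μ k₀ L v k) (h' : Regular hUC σ init μ k₀ L v (k + 1)) (hN : k + 1 ≤ N) :
    Quiet hUC σ init μ k₀ L v (k + 1) := by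
  have heq : runChannel hUC σ init v (k + 1) = runChannel hUC σ init v k :=
    funext fun j => h.1.runChannel_succ ht hσ h' hN (h.2 j)
  exact ⟨h', heq ▸ h.2⟩

/-- In a regular slot the undersampled channel `y` is not the one sensed. To leave the top ranks it
would have to be overtaken by some unsensed `x` with more samples, but the index of `y` grows
strictly faster. -/
theorem Regular.inexperienced_succ (ht : Thresholds μ δ k₀ L N) (hσ : IsRankingRule σ)
    (h : Regular hUC σ init μ k₀ L v k) {j : Fin U} (hj : Inexperienced hUC σ init L v k j) :
    Inexperienced hUC σ init L v (k + 1) j := by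
  obtain ⟨⟨hk, hc⟩, he⟩ := h
  have hCk := ht.le.trans hk
  have h1 := one_le_of_thresholds hUC ht hk
  have hch := runChannel_eq hUC σ init v hCk j
  have hfresh := he j
  obtain ⟨r, hr⟩ := hj
  by_contra hcon
  unfold Inexperienced at hcon
  push Not at hcon
  set π := σ (gMean (runState hUC σ init v k) k j) with hπ
  set π' := σ (gMean (runState hUC σ init v (k + 1)) (k + 1) j) with hπ'
  set y := π (Fin.castLE hUC r) with hy
  have hexp : ∀ i, (π'.symm i : ℕ) < U → L ≤ (runState hUC σ init v (k + 1)).sensed j i := by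
    intro i hi
    have := hcon ⟨π'.symm i, hi⟩
    rwa [show Fin.castLE hUC ⟨(π'.symm i : ℕ), hi⟩ = π'.symm i from rfl,
      Equiv.apply_symm_apply] at this
  have hyc : y ≠ runChannel hUC σ init v k j := fun h => by
    rw [← h] at hfresh
    omega
  have hys : (runState hUC σ init v (k + 1)).sensed j y = (runState hUC σ init v k).sensed j y := by
    simp [runState_succ, hyc.symm]
  have hy1 : (π.symm y : ℕ) < U := by simp [hy]
  have hy2 : ¬ (π'.symm y : ℕ) < U := fun hlt => by
    have := hexp y hlt
    omega
  obtain ⟨x, hx, hx'⟩ := exists_symm_lt_of_exists hy1 hy2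
  have hxc : x ≠ runChannel hUC σ init v k j := fun h => by
    refine hx' ?_
    rw [h, hch]
    simp
  have hxs : (runState hUC σ init v (k + 1)).sensed j x = (runState hUC σ init v k).sensed j x := by
    simp [runState_succ, hxc.symm]
  have hxy : (runState hUC σ init v k).sensed j y < (runState hUC σ init v k).sensed j x := by
    have := hexp x hx
    omega
  have e1 := le_of_symm_le (hσ (gMean (runState hUC σ init v k) k j)) (i := y) (i' := x)
    (Fin.le_def.2 (by rw [← hπ]; omega))
  have e2 := le_of_symm_le (hσ (gMean (runState hUC σ init v (k + 1)) (k + 1) j)) (i := x) (i' := y)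
    (Fin.le_def.2 (by rw [← hπ']; omega))
  have e3 := gMean_succ_of_ne hxc
  have e4 := gMean_succ_of_ne hyc
  have hypos : (0 : ℝ) < (runState hUC σ init v k).sensed j y := by
    exact_mod_cast sensed_pos hUC σ init v hCk j y
  have e5 : (√(2 * Real.log (k + 1 : ℕ)) - √(2 * Real.log k)) /
      √((runState hUC σ init v k).sensed j x) < (√(2 * Real.log (k + 1 : ℕ)) - √(2 * Real.log k)) /
      √((runState hUC σ init v k).sensed j y) :=
    div_lt_div_of_pos_left (sub_pos.2 (sqrt_two_log_lt h1)) (Real.sqrt_pos.2 hypos)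
      (Real.sqrt_lt_sqrt hypos.le (by exact_mod_cast hxy))
  linarith

theorem ranking_eq_of_not_inexperienced (ht : Thresholds μ δ k₀ L N) (hσ : IsRankingRule σ)
    (h : Reliable hUC σ init μ k₀ v k) (hN : k ≤ N) {j : Fin U}
    (hj : ¬ Inexperienced hUC σ init L v k j) (r : Fin U) :
    σ (gMean (runState hUC σ init v k) k j) (Fin.castLE hUC r) = σ μ (Fin.castLE hUC r) := by
  obtain ⟨hk, hc⟩ := h
  unfold Inexperienced at hj
  push Not at hj
  refine ranking_eq_of_accurate ht.pos ht.sep ht.injective (hσ _) (hσ _) (fun i => (hc j i).1)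
    (m := U) (fun p hp => ?_) (by simp)
  exact gMean_le_of_confident ht hc (one_le_of_thresholds hUC ht hk) hN
    (sensed_pos hUC σ init v (ht.le.trans hk) _ _) (hj ⟨p, hp⟩)

end Slots

/-! ### Collisions are resolved or lead to exploration -/

section Draws

variable {U C : ℕ} [NeZero U] {hUC : U ≤ C}
  {σ : (Fin C → ℝ) → Equiv.Perm (Fin C)} {init : Fin U → Equiv.Perm (Fin C)} {μ : Fin C → ℝ}
  {k₀ L : ℕ} {δ : ℝ} {N k : ℕ} {v : ℕ → Input U C}

theorem _root_.DependsOn.apply_update {α β : Type*} {f : (ℕ → α) → β} {m n : ℕ}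
    (hf : DependsOn f (Set.Iio m)) (hmn : m ≤ n) (v : ℕ → α) (x : α) :
    f (Function.update v n x) = f v := by
  refine hf fun i hi => ?_
  have := Set.mem_Iio.1 hi
  exact Function.update_of_ne (by omega) _ _

theorem dependsOn_regular {m : ℕ} (hkm : k < m) :
    DependsOn (fun v => Regular hUC σ init μ k₀ L v k) (Set.Iio m) :=
  dependsOn_of_runState_prod hUC σ init hkm fun s x => (k₀ ≤ k ∧ Confident μ k s) ∧
    ∀ j, L ≤ s.sensed j (slotChannel hUC σ init k s x.2 j)

theorem dependsOn_active {m : ℕ} (hkm : k < m) :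
    DependsOn (fun v => Active hUC σ init μ k₀ L v k) (Set.Iio m) :=
  dependsOn_of_runState_prod hUC σ init hkm fun s x => ((k₀ ≤ k ∧ Confident μ k s) ∧
    ∀ j, L ≤ s.sensed j (slotChannel hUC σ init k s x.2 j)) ∧
    ∃ j, Collides (slotChannel hUC σ init k s x.2) j

theorem dependsOn_quiet {m : ℕ} (hkm : k < m) :
    DependsOn (fun v => Quiet hUC σ init μ k₀ L v k) (Set.Iio m) :=
  dependsOn_of_runState_prod hUC σ init hkm fun s x => ((k₀ ≤ k ∧ Confident μ k s) ∧
    ∀ j, L ≤ s.sensed j (slotChannel hUC σ init k s x.2 j)) ∧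
    ∀ j, ¬ Collides (slotChannel hUC σ init k s x.2) j

theorem dependsOn_unstable {m : ℕ} (hkm : k ≤ m) :
    DependsOn (fun v => Unstable hUC σ init μ k₀ L v k) (Set.Iio m) :=
  dependsOn_of_runState hUC σ init hkm fun s => ¬ (k₀ ≤ k ∧ Confident μ k s) ∨
    ∃ j, s.collided j = true ∧ ∃ r : Fin U, s.sensed j (σ (gMean s k j) (Fin.castLE hUC r)) < L

theorem dependsOn_reliable {m : ℕ} (hkm : k ≤ m) :
    DependsOn (fun v => Reliable hUC σ init μ k₀ v k) (Set.Iio m) :=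
  dependsOn_of_runState hUC σ init hkm fun s => k₀ ≤ k ∧ Confident μ k s

theorem reliable_update_self (x : Input U C) :
    Reliable hUC σ init μ k₀ (Function.update v k x) k ↔ Reliable hUC σ init μ k₀ v k :=
  iff_of_eq ((dependsOn_reliable le_rfl).apply_update le_rfl v x)

theorem inexperienced_update_self (x : Input U C) (j : Fin U) :
    Inexperienced hUC σ init L (Function.update v k x) k j ↔ Inexperienced hUC σ init L v k j := by
  simp only [Inexperienced, runState_update hUC σ init v le_rfl]

/-- Reliability does not depend on the draw. Otherwise a user that must redraw can pick the rank of
its undersampled channel. -/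
theorem Unstable.exists_draw (hk : C ≤ k) (h : Unstable hUC σ init μ k₀ L v k) :
    ∃ d, ∀ w, ¬ Regular hUC σ init μ k₀ L (Function.update v k (w, d)) k := by
  rcases h with h | ⟨j, hj, r, hr⟩
  · exact ⟨fun _ => 0, fun w hreg => h ((reliable_update_self _).1 hreg.1)⟩
  · refine ⟨fun _ => r, fun w hreg => ?_⟩
    have := hreg.2 j
    rw [runChannel_update_self, runState_update hUC σ init v le_rfl] at this
    simp only [slotChannel, hk.not_gt, dif_neg, not_false_eq_true, slotRank, hj, if_true] at this
    omega

/-- If the next slot is not unstable, every colliding user already ranks the top channels correctly.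
It can therefore either target a chosen user that did not collide or help to complete an orthogonal
assignment. -/
theorem Active.exists_draw (ht : Thresholds μ δ k₀ L N) (hσ : IsRankingRule σ)
    (h : Active hUC σ init μ k₀ L v k) (hN : k + 1 ≤ N) :
    ∃ d, ∀ w, ¬ Regular hUC σ init μ k₀ L (Function.update v (k + 1) (w, d)) (k + 1) ∨
      Quiet hUC σ init μ k₀ L (Function.update v (k + 1) (w, d)) (k + 1) ∨
      Unstable hUC σ init μ k₀ L (Function.update v (k + 1) (w, d)) (k + 2) := by
  have hk0 : k₀ ≤ k := h.1.1.1
  have hCk : C ≤ k + 1 := (ht.le.trans hk0).trans k.le_succ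
  have hcoll : ∀ j, (runState hUC σ init v (k + 1)).collided j = true ↔
      Collides (runChannel hUC σ init v k) j := by
    intro j
    simp [runState_succ, ht.le.trans hk0]
  by_cases hun : Unstable hUC σ init μ k₀ L v (k + 1)
  · obtain ⟨d, hd⟩ := hun.exists_draw hCk
    exact ⟨d, fun w => Or.inl (hd w)⟩
  unfold Unstable at hun
  push Not at hun
  obtain ⟨hrel, hexp⟩ := hun
  obtain ⟨c, hc⟩ := h.2
  have hcflag := (hcoll c).2 hc
  have hcrank := ranking_eq_of_not_inexperienced ht hσ hrel hN (hexp c hcflag)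
  by_cases hinc : ∃ j, Inexperienced hUC σ init L v (k + 1) j
  · obtain ⟨j, hj⟩ := hinc
    have hjflag : ¬ (runState hUC σ init v (k + 1)).collided j = true := fun hf => hexp j hf hj
    have hjc : j ≠ c := fun h => hjflag (h ▸ hcflag)
    -- the channel that `j` senses next, whatever the draw
    set s := runState hUC σ init v (k + 1) with hs
    set a := σ (gMean s (k + 1) j) (Fin.castLE hUC (s.rank j)) with ha
    by_cases haL : L ≤ s.sensed j a
    · have hup : gMean s (k + 1) j a ≤ μ a + δ / 2 :=
        gMean_le_of_confident ht hrel.2 (by omega) hN (sensed_pos hUC σ init v hCk _ _) haL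
      have hle := true_rank_le ht.pos ht.sep ht.injective (hσ (gMean s (k + 1) j)) (hσ μ)
        (fun i => (hrel.2 j i).1) hup
      have hlt : ((σ μ).symm a : ℕ) < U := lt_of_le_of_lt (Fin.le_def.1 hle) (by simp)
      -- Since `c` ranks correctly, drawing the true rank of `a` sends it to `a`, which `j` senses
      -- regardless of the draw. Then `j` must redraw one slot later while still inexperienced. Only
      -- colliding users read the draw, so it may be constant.
      refine ⟨fun _ => ⟨(σ μ).symm a, hlt⟩, fun w => ?_⟩
      rw [or_iff_not_imp_left, not_not]
      intro hreg
      refine Or.inr (Or.inr ⟨j, ?_, ?_⟩)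
      · rw [runState_succ, decide_eq_true_iff]
        refine ⟨hCk, c, hjc.symm, ?_⟩
        rw [runChannel_update_self, ← hs]
        simp only [slotChannel, hCk.not_gt, dif_neg, not_false_eq_true, slotRank, hcflag, if_true,
          hjflag]
        rw [hcrank]
        rw [show Fin.castLE hUC ⟨((σ μ).symm a : ℕ), hlt⟩ = (σ μ).symm a from rfl,
          Equiv.apply_symm_apply]
        rfl
      · exact hreg.inexperienced_succ ht hσ ((inexperienced_update_self _ _).2 hj)
    -- Whatever is drawn, `j` keeps its rank and senses the undersampled channel `a`.
    · refine ⟨fun _ => 0, fun w => Or.inl fun hreg => haL ?_⟩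
      have := hreg.2 j
      rw [runChannel_update_self, runState_update hUC σ init v le_rfl] at this
      simpa only [slotChannel, hCk.not_gt, dif_neg, not_false_eq_true, slotRank, ← hs, hjflag,
        Bool.false_eq_true, if_false] using this
  · push Not at hinc
    have hrank : ∀ j r, σ (gMean (runState hUC σ init v (k + 1)) (k + 1) j) (Fin.castLE hUC r) =
        σ μ (Fin.castLE hUC r) :=
      fun j => ranking_eq_of_not_inexperienced ht hσ hrel hN (hinc j)
    have hreg : ∀ x, Regular hUC σ init μ k₀ L (Function.update v (k + 1) x) (k + 1) := by
      refine fun x => ⟨(reliable_update_self _).2 hrel, fun j => ?_⟩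
      have hj := hinc j
      unfold Inexperienced at hj
      push Not at hj
      rw [runChannel_eq hUC σ init _ hCk, runState_update hUC σ init v le_rfl]
      exact hj _
    have hch : ∀ x j, runChannel hUC σ init (Function.update v (k + 1) x) (k + 1) j =
        σ μ (Fin.castLE hUC (slotRank (runState hUC σ init v (k + 1)) x.2 j)) := by
      intro x j
      rw [runChannel_eq hUC σ init _ hCk, runState_update hUC σ init v le_rfl, hrank,
        runRank_update_self]
    -- Non-colliding users stay put in slot `k + 1`, where the ranking is correct; so already in
    -- slot `k` they sat on the true channel of their rank, and distinct channels force distinct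
    -- ranks. The colliding users can then fill the remaining ranks.
    have hinj : Set.InjOn (runRank hUC σ init v k)
        {j | ¬ Collides (runChannel hUC σ init v k) j} := by
      intro j hj j' hj' heq
      by_contra hne
      refine hj ⟨j', Ne.symm hne, ?_⟩
      have hregk : ∀ x, Regular hUC σ init μ k₀ L (Function.update v (k + 1) x) k := fun x => by
        have := (dependsOn_regular (hUC := hUC) (σ := σ) (init := init) (μ := μ) (k₀ := k₀) (L := L)
          (Nat.lt_succ_self k)).apply_update le_rfl v x
        exact this ▸ h.1
      have hstay : ∀ i, ¬ Collides (runChannel hUC σ init v k) i → runChannel hUC σ init v k i =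
          σ μ (Fin.castLE hUC (runRank hUC σ init v k i)) := by
        intro i hi
        have hv : Function.update v (k + 1) (v (k + 1)) = v := Function.update_eq_self _ _
        have h1 := (hregk (v (k + 1))).runChannel_succ ht hσ (hreg _) hN (j := i) (by rwa [hv])
        rw [hch, hv] at h1
        rw [← h1]
        have hi' : ¬ (runState hUC σ init v (k + 1)).collided i = true := fun hf =>
          hi ((hcoll i).1 hf)
        simp only [slotRank, hi']
        rfl
      rw [hstay j hj, hstay j' hj', heq]
    obtain ⟨y, hy, hyx⟩ := exists_injective_extension _ _ hinj
    refine ⟨y, fun w => Or.inr (Or.inl ⟨hreg _, ?_⟩)⟩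
    have hslot : slotRank (runState hUC σ init v (k + 1)) y = y := by
      funext j
      by_cases hj : (runState hUC σ init v (k + 1)).collided j = true
      · simp [slotRank, hj]
      · simp only [slotRank, hj]
        exact (hyx j fun hc => hj ((hcoll j).2 hc)).symm
    rintro j ⟨j', hne, heq⟩
    rw [hch, hch] at heq
    simp only [hslot, (σ μ).injective.eq_iff, (Fin.castLE_injective hUC).eq_iff] at heq
    exact hne (hy heq)

end Draws

/-! ### From favourable draws to counts of active slots -/

section Probability

variable {Ω : Type*} [MeasurableSpace Ω] {P : Measure Ω} [IsProbabilityMeasure P] {U C : ℕ}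
  [NeZero U] {hUC : U ≤ C}
  {σ : (Fin C → ℝ) → Equiv.Perm (Fin C)} {init : Fin U → Equiv.Perm (Fin C)}
  {μ : Fin C → ℝ} {W : ℕ → Fin C → Ω → Bool} {D : ℕ → Fin U → Ω → Fin U}
  {k₀ L : ℕ} {δ : ℝ} {N k : ℕ}

/-- An active slot is followed, with a probability bounded below, by an irregular one within two
slots or by a quiet one. -/
theorem IsModel.measure_active_le (hM : IsModel P μ W D) (hμ : ∀ i, μ i ∈ Set.Ioo (0 : ℝ) 1)
    (ht : Thresholds μ δ k₀ L N) (hσ : IsRankingRule σ) (hN : k + 1 ≤ N) :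
    P {ω | Active hUC σ init μ k₀ L (inputs W D ω) k} * ((U : ℝ≥0∞)⁻¹) ^ U * ((U : ℝ≥0∞)⁻¹) ^ U ≤
      P {ω | Active hUC σ init μ k₀ L (inputs W D ω) k ∧
        (¬ Regular hUC σ init μ k₀ L (inputs W D ω) (k + 1) ∨
          ¬ Regular hUC σ init μ k₀ L (inputs W D ω) (k + 2) ∨
          Quiet hUC σ init μ k₀ L (inputs W D ω) (k + 1))} := by
  let A : (ℕ → Input U C) → Prop := fun v => Active hUC σ init μ k₀ L v k
  let R₁ : (ℕ → Input U C) → Prop := fun v => Regular hUC σ init μ k₀ L v (k + 1)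
  let R₂ : (ℕ → Input U C) → Prop := fun v => Regular hUC σ init μ k₀ L v (k + 2)
  let Q : (ℕ → Input U C) → Prop := fun v => Quiet hUC σ init μ k₀ L v (k + 1)
  let S : (ℕ → Input U C) → Prop := fun v => Unstable hUC σ init μ k₀ L v (k + 2)
  have hA : ∀ {m}, k < m → DependsOn A (Set.Iio m) := fun h => dependsOn_active h
  have hR₁ : ∀ {m}, k + 1 < m → DependsOn R₁ (Set.Iio m) := fun h => dependsOn_regular h
  have hR₂ : ∀ {m}, k + 2 < m → DependsOn R₂ (Set.Iio m) := fun h => dependsOn_regular h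
  have hQ : ∀ {m}, k + 1 < m → DependsOn Q (Set.Iio m) := fun h => dependsOn_quiet h
  have hS : ∀ {m}, k + 2 ≤ m → DependsOn S (Set.Iio m) := fun h => dependsOn_unstable h
  have hB₁ : DependsOn (fun v => A v ∧ (¬ R₁ v ∨ Q v ∨ S v)) (Set.Iio (k + 1 + 1)) := by
    intro v v' h
    simp only [hA (by omega : k < k + 1 + 1) h, hR₁ (by omega : k + 1 < k + 1 + 1) h,
      hQ (by omega : k + 1 < k + 1 + 1) h, hS (by omega : k + 2 ≤ k + 1 + 1) h]
  have hB₂ : DependsOn (fun v => A v ∧ (¬ R₁ v ∨ ¬ R₂ v ∨ Q v)) (Set.Iio (k + 2 + 1)) := by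
    intro v v' h
    simp only [hA (by omega : k < k + 2 + 1) h, hR₁ (by omega : k + 1 < k + 2 + 1) h,
      hQ (by omega : k + 1 < k + 2 + 1) h, hR₂ (by omega : k + 2 < k + 2 + 1) h]
  -- Two draws are prescribed in turn: that of slot `k + 1` may only create an unstable state, which
  -- that of slot `k + 2` turns into an irregular slot.
  have h₁ := hM.measure_mul_le_of_exists_draw hμ (hA (Nat.lt_succ_self k)) hB₁ (by
    intro v hv
    obtain ⟨d, hd⟩ := Active.exists_draw ht hσ hv hN
    refine ⟨d, fun w => ⟨?_, hd w⟩⟩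
    rw [(hA (Nat.lt_succ_self k)).apply_update le_rfl]
    exact hv)
  have h₂ := hM.measure_mul_le_of_exists_draw hμ hB₁ hB₂ (by
    rintro v ⟨hv, hor⟩
    have hup : ∀ x, A (Function.update v (k + 2) x) := fun x => by
      rw [(hA (by omega : k < k + 2)).apply_update le_rfl]
      exact hv
    have hup₁ : ∀ x, R₁ (Function.update v (k + 2) x) = R₁ v := fun x =>
      (hR₁ (by omega : k + 1 < k + 2)).apply_update le_rfl v x
    have hupQ : ∀ x, Q (Function.update v (k + 2) x) = Q v := fun x =>
      (hQ (by omega : k + 1 < k + 2)).apply_update le_rfl v x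
    by_cases hs : S v
    · have hk0 : k₀ ≤ k := hv.1.1.1
      obtain ⟨d, hd⟩ := Unstable.exists_draw (by have := ht.le; omega) hs
      exact ⟨d, fun w => ⟨hup _, Or.inr (Or.inl (hd w))⟩⟩
    · refine ⟨fun _ => 0, fun w => ⟨hup _, ?_⟩⟩
      rw [hup₁, hupQ]
      tauto)
  exact (mul_le_mul_left h₁ _).trans h₂

open Classical in
/-- Along a run, the transitions from active to quiet slots are at most as many as the irregular
slots, up to one. -/
theorem card_active_quiet_le (ht : Thresholds μ δ k₀ L N) (hσ : IsRankingRule σ)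
    (v : ℕ → Input U C) {n : ℕ} (hn : n ≤ N) :
    ((Finset.range n).filter fun k => Active hUC σ init μ k₀ L v k ∧
      Quiet hUC σ init μ k₀ L v (k + 1)).card ≤
    ((Finset.range (n + 1)).filter fun k => ¬ Regular hUC σ init μ k₀ L v k).card +
      if Quiet hUC σ init μ k₀ L v n then 1 else 0 := by
  induction n with
  | zero => simp
  | succ n ih =>
    have ih := ih (by omega)
    simp only [Finset.card_filter] at ih ⊢
    rw [Finset.sum_range_succ, Finset.sum_range_succ (n := n + 1)]
    have hsplit : ¬ (Active hUC σ init μ k₀ L v n ∧ Quiet hUC σ init μ k₀ L v n) :=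
      fun h => by
        obtain ⟨j, hj⟩ := h.1.2
        exact h.2.2 j hj
    have hsucc : Quiet hUC σ init μ k₀ L v n → Regular hUC σ init μ k₀ L v (n + 1) →
        Quiet hUC σ init μ k₀ L v (n + 1) := fun h h' => h.succ ht hσ h' hn
    -- The indicator of a quiet slot acts as a potential: an active-to-quiet transition raises it
    -- from zero to one, and it can fall only at an irregular slot `n + 1`, counted on the right.
    by_cases ha : Active hUC σ init μ k₀ L v n <;>
      by_cases hq : Quiet hUC σ init μ k₀ L v n <;>
      by_cases hr : Regular hUC σ init μ k₀ L v (n + 1) <;>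
      by_cases hq' : Quiet hUC σ init μ k₀ L v (n + 1) <;>
      simp [ha, hq, hr, hq'] at ih hsplit hsucc ⊢ <;> omega

end Probability

/-! ### Concentration of the sample means -/

/-- Hoeffding's lemma for a Bernoulli variable. -/
theorem bernoulli_mgf_le {m : ℝ} (hm : m ∈ Set.Ioo (0 : ℝ) 1) (l : ℝ) :
    m * Real.exp (l * (1 - m)) + (1 - m) * Real.exp (l * (0 - m)) ≤ Real.exp (l ^ 2 / 8) := by
  have hm0 : 0 ≤ m := hm.1.le
  have hm1 : 0 ≤ 1 - m := by linarith [hm.2]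
  let ν : Measure Bool :=
    ENNReal.ofReal m • Measure.dirac true + ENNReal.ofReal (1 - m) • Measure.dirac false
  have hν : IsProbabilityMeasure ν := ⟨by
    simp only [ν, Measure.add_apply, Measure.smul_apply, measure_univ, smul_eq_mul, mul_one]
    rw [← ENNReal.ofReal_add hm0 hm1]
    simp⟩
  have hInt : ∀ f : Bool → ℝ, ∫ b, f b ∂ν = m * f true + (1 - m) * f false := by
    intro f
    have hfin : ∀ (p : ℝ) (b : Bool), IsFiniteMeasure (ENNReal.ofReal p • Measure.dirac b) :=
      fun p b => Measure.smul_finite _ ENNReal.ofReal_ne_top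
    rw [integral_add_measure Integrable.of_finite Integrable.of_finite, integral_smul_measure,
      integral_smul_measure, integral_dirac, integral_dirac, ENNReal.toReal_ofReal hm0,
      ENNReal.toReal_ofReal hm1]
    simp
  let X : Bool → ℝ := fun b => (if b then 1 else 0) - m
  have hX := hasSubgaussianMGF_of_mem_Icc_of_integral_eq_zero (μ := ν) (X := X) (a := 0 - m)
    (b := 1 - m) Measurable.of_discrete.aemeasurable
    (Filter.Eventually.of_forall fun b => by cases b <;> simp [X])
    (by rw [hInt]; simp [X]; ring)
  have h := hX.mgf_le l
  rw [mgf, hInt] at h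
  simp only [X, if_true, Bool.false_eq_true, if_false] at h
  refine h.trans (le_of_eq ?_)
  congr 1
  have : ‖(1 - m) - (0 - m)‖ = 1 := by
    rw [show (1 - m) - (0 - m) = 1 by ring]
    simp
  push_cast
  rw [this]
  ring

section Concentration

variable {Ω : Type*} [MeasurableSpace Ω] {P : Measure Ω} [IsProbabilityMeasure P] {U C : ℕ}
  [NeZero U] {hUC : U ≤ C}
  {σ : (Fin C → ℝ) → Equiv.Perm (Fin C)} {init : Fin U → Equiv.Perm (Fin C)}
  {μ : Fin C → ℝ} {W : ℕ → Fin C → Ω → Bool} {D : ℕ → Fin U → Ω → Fin U}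

/-- The exponential supermartingale of the observations of channel `i` by user `j`. -/
def expWeight (m l : ℝ) (s : State U C) (j : Fin U) (i : Fin C) : ℝ≥0∞ :=
  ENNReal.ofReal (Real.exp (l * (s.free j i - m * s.sensed j i) - l ^ 2 / 8 * s.sensed j i))

/-- The factor by which `expWeight` changes in a slot in which the channel is sensed. -/
def expFactor (m l : ℝ) (b : Bool) : ℝ≥0∞ :=
  ENNReal.ofReal (Real.exp (l * ((if b then 1 else 0) - m) - l ^ 2 / 8))

theorem sum_bernoulliWeight_mul_expFactor_le {m : ℝ} (hm : m ∈ Set.Ioo (0 : ℝ) 1) (l : ℝ) :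
    ∑ b, bernoulliWeight m b * expFactor m l b ≤ 1 := by
  have hm0 : 0 ≤ m := hm.1.le
  have hm1 : 0 ≤ 1 - m := by linarith [hm.2]
  simp only [Fintype.sum_bool, bernoulliWeight, expFactor, if_true, Bool.false_eq_true, if_false]
  rw [← ENNReal.ofReal_mul hm0, ← ENNReal.ofReal_mul hm1,
    ← ENNReal.ofReal_add (by positivity) (by positivity), ← ENNReal.ofReal_one]
  refine ENNReal.ofReal_le_ofReal ?_
  rw [Real.exp_sub, Real.exp_sub]
  have h := bernoulli_mgf_le hm l
  calc m * (Real.exp (l * (1 - m)) / Real.exp (l ^ 2 / 8)) +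
        (1 - m) * (Real.exp (l * (0 - m)) / Real.exp (l ^ 2 / 8))
      = (m * Real.exp (l * (1 - m)) + (1 - m) * Real.exp (l * (0 - m))) / Real.exp (l ^ 2 / 8) := by
        ring
    _ ≤ 1 := (div_le_one (Real.exp_pos _)).2 h

theorem expWeight_runState_succ (m l : ℝ) (v : ℕ → Input U C) (k : ℕ) (j : Fin U) (i : Fin C) :
    expWeight m l (runState hUC σ init v (k + 1)) j i =
      expWeight m l (runState hUC σ init v k) j i *
        if runChannel hUC σ init v k j = i then expFactor m l ((v k).1 i) else 1 := by
  rw [runState_succ]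
  by_cases h : runChannel hUC σ init v k j = i
  · simp only [expWeight, expFactor, h, if_true, true_and]
    rw [← ENNReal.ofReal_mul (Real.exp_pos _).le, ← Real.exp_add]
    congr 2
    push_cast
    ring
  · simp [expWeight, h]

/-- Whether the channel is sensed depends on the past and the rank draws, not on the present
availability. Averaging over that availability, Hoeffding's lemma bounds the mean factor by one. -/
theorem IsModel.lintegral_expWeight_le (hM : IsModel P μ W D) (hμ : ∀ i, μ i ∈ Set.Ioo (0 : ℝ) 1)
    (l : ℝ) (k : ℕ) (j : Fin U) (i : Fin C) :
    ∫⁻ ω, expWeight (μ i) l (runState hUC σ init (inputs W D ω) k) j i ∂P ≤ 1 := by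
  induction k with
  | zero => simp [expWeight, runState, stateAfter]
  | succ k ih =>
    refine le_trans ?_ ih
    rw [hM.lintegral_resample hμ (dependsOn_of_runState hUC σ init le_rfl fun s =>
      expWeight (μ i) l s j i)]
    refine lintegral_mono fun ω => ?_
    set v := inputs W D ω
    simp only [expWeight_runState_succ, runState_update hUC σ init v le_rfl,
      runChannel_update_self, Function.update_self]
    refine le_trans (le_of_eq (sum_inputWeight_mul hμ i fun d b =>
      expWeight (μ i) l (runState hUC σ init v k) j i *
        if slotChannel hUC σ init k (runState hUC σ init v k) d j = i then
          expFactor (μ i) l b else 1)) ?_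
    calc ∑ d, ((U : ℝ≥0∞)⁻¹) ^ U * ∑ b, bernoulliWeight (μ i) b *
          (expWeight (μ i) l (runState hUC σ init v k) j i *
            if slotChannel hUC σ init k (runState hUC σ init v k) d j = i then
              expFactor (μ i) l b else 1)
        ≤ ∑ _d : Fin U → Fin U, ((U : ℝ≥0∞)⁻¹) ^ U *
          expWeight (μ i) l (runState hUC σ init v k) j i := by
          refine Finset.sum_le_sum fun d _ => mul_le_mul_right ?_ _
          simp_rw [mul_left_comm (bernoulliWeight _ _)]
          rw [← Finset.mul_sum]
          refine mul_le_of_le_one_right' ?_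
          split_ifs
          · exact sum_bernoulliWeight_mul_expFactor_le (hμ i) l
          · simp only [mul_one]
            exact (sum_bernoulliWeight (hμ i)).le
      _ = expWeight (μ i) l (runState hUC σ init v k) j i := by
          rw [← Finset.sum_mul, sum_uniformWeight, one_mul]

/-- The two-sided deviation bound at a given number of samples; `e = 1` or `e = -1`. -/
theorem IsModel.measure_deviation_le (hM : IsModel P μ W D) (hμ : ∀ i, μ i ∈ Set.Ioo (0 : ℝ) 1)
    {k : ℕ} (hk : 1 ≤ k) (j : Fin U) (i : Fin C) {t : ℕ} (ht : 1 ≤ t) {e : ℝ} (he : e ^ 2 = 1) :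
    P {ω | (runState hUC σ init (inputs W D ω) k).sensed j i = t ∧
      √(2 * Real.log k / t) * t ≤ e * ((runState hUC σ init (inputs W D ω) k).free j i -
        μ i * (runState hUC σ init (inputs W D ω) k).sensed j i)} ≤
      ENNReal.ofReal (((k : ℝ) ^ 4)⁻¹) := by
  set q : ℝ := √(2 * Real.log k / t) with hq
  have hk' : (1 : ℝ) ≤ k := by exact_mod_cast hk
  have ht' : (0 : ℝ) < t := by exact_mod_cast ht
  have hlog := Real.log_nonneg hk'
  have hq0 : 0 ≤ q := Real.sqrt_nonneg _
  have hq2 : q ^ 2 * t = 2 * Real.log k := by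
    rw [hq, Real.sq_sqrt (by positivity)]
    field_simp
  have hpow : (0 : ℝ) < (k : ℝ) ^ 4 := by positivity
  -- The parameter `4 * e * q` is the optimal Chernoff choice: on the event the exponent is at least
  -- `4 * q ^ 2 * t - 2 * q ^ 2 * t = 4 * log k`, whence Markov's inequality gives `k ^ (-4)`.
  have hmeas : Measurable fun ω =>
      expWeight (μ i) (4 * e * q) (runState hUC σ init (inputs W D ω) k) j i :=
    hM.measurable_of_dependsOn (k := k) (dependsOn_of_runState hUC σ init le_rfl fun s =>
      expWeight (μ i) (4 * e * q) s j i)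
  have hsub : {ω | (runState hUC σ init (inputs W D ω) k).sensed j i = t ∧
      q * t ≤ e * ((runState hUC σ init (inputs W D ω) k).free j i -
        μ i * (runState hUC σ init (inputs W D ω) k).sensed j i)} ⊆
      {ω | ENNReal.ofReal ((k : ℝ) ^ 4) ≤
        expWeight (μ i) (4 * e * q) (runState hUC σ init (inputs W D ω) k) j i} := by
    rintro ω ⟨h1, h2⟩
    refine ENNReal.ofReal_le_ofReal ?_
    rw [show (k : ℝ) ^ 4 = Real.exp (4 * Real.log k) by
      rw [mul_comm, Real.exp_mul, Real.exp_log (by linarith)]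
      norm_cast]
    refine Real.exp_le_exp.2 ?_
    rw [h1] at h2 ⊢
    have h3 := mul_le_mul_of_nonneg_left h2 (by positivity : 0 ≤ 4 * q)
    have h4 : (4 * e * q) ^ 2 / 8 * t = 2 * (q ^ 2 * t) := by
      rw [mul_pow, mul_pow, he]; ring
    rw [h4]
    nlinarith [h3, hq2]
  refine (measure_mono hsub).trans ?_
  have hmk := mul_meas_ge_le_lintegral (μ := P) hmeas (ENNReal.ofReal ((k : ℝ) ^ 4))
  have hle := hmk.trans (hM.lintegral_expWeight_le hμ (4 * e * q) k j i)
  rw [ENNReal.ofReal_inv_of_pos hpow]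
  rw [ENNReal.le_inv_iff_mul_le, mul_comm]
  exact hle

/-- The sample count is random and depends on the observations, so the union bound runs over its `k`
possible values as well as users, channels and both signs. This costs one power of `k` and leaves a
summable bound. -/
theorem IsModel.measure_not_confident_le (hM : IsModel P μ W D) (hμ : ∀ i, μ i ∈ Set.Ioo (0 : ℝ) 1)
    {k : ℕ} (hk : C ≤ k) :
    P {ω | ¬ Confident μ k (runState hUC σ init (inputs W D ω) k)} ≤
      ENNReal.ofReal (2 * U * C * ((k : ℝ) ^ 3)⁻¹) := by
  have hk1 : 1 ≤ k := ((NeZero.pos U).trans_le hUC).trans_le hk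
  have hk' : (0 : ℝ) < k := by exact_mod_cast hk1
  let E : Fin U → Fin C → ℕ → ℝ → Set Ω := fun j i t e =>
    {ω | (runState hUC σ init (inputs W D ω) k).sensed j i = t ∧
      √(2 * Real.log k / t) * t ≤ e * ((runState hUC σ init (inputs W D ω) k).free j i -
        μ i * (runState hUC σ init (inputs W D ω) k).sensed j i)}
  have hsub : {ω | ¬ Confident μ k (runState hUC σ init (inputs W D ω) k)} ⊆
      ⋃ j, ⋃ i, ⋃ t ∈ Finset.Icc 1 k, (E j i t 1 ∪ E j i t (-1)) := by
    intro ω hω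
    have hω' : ¬ Confident μ k (runState hUC σ init (inputs W D ω) k) := hω
    unfold Confident at hω'
    push Not at hω'
    obtain ⟨j, i, hji⟩ := hω'
    have hpos := sensed_pos hUC σ init (inputs W D ω) hk j i
    have hle := sensed_le hUC σ init (inputs W D ω) k j i
    simp only [Set.mem_iUnion]
    refine ⟨j, i, _, Finset.mem_Icc.2 ⟨hpos, hle⟩, ?_⟩
    set s := runState hUC σ init (inputs W D ω) k with hs
    have hT : (0 : ℝ) < s.sensed j i := by exact_mod_cast hpos
    have hfree : (s.free j i : ℝ) = (s.free j i : ℝ) / s.sensed j i * s.sensed j i := by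
      field_simp
    by_cases h1 : μ i ≤ gMean s k j i
    · refine Or.inl ⟨hs ▸ rfl, ?_⟩
      have := mul_le_mul_of_nonneg_right (hji h1).le hT.le
      rw [← hfree] at this
      linarith
    · refine Or.inr ⟨hs ▸ rfl, ?_⟩
      have := mul_le_mul_of_nonneg_right (not_le.1 h1).le hT.le
      rw [gMean, add_mul, ← hfree] at this
      linarith
  calc P {ω | ¬ Confident μ k (runState hUC σ init (inputs W D ω) k)}
      ≤ ∑ j : Fin U, ∑ i : Fin C, ∑ t ∈ Finset.Icc 1 k, (P (E j i t 1) + P (E j i t (-1))) := by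
        refine (measure_mono hsub).trans ?_
        refine (measure_iUnion_fintype_le _ _).trans (Finset.sum_le_sum fun j _ => ?_)
        refine (measure_iUnion_fintype_le _ _).trans (Finset.sum_le_sum fun i _ => ?_)
        refine (measure_biUnion_finset_le _ _).trans (Finset.sum_le_sum fun t _ => ?_)
        exact measure_union_le _ _
    _ ≤ ∑ _j : Fin U, ∑ _i : Fin C, ∑ _t ∈ Finset.Icc 1 k,
          (ENNReal.ofReal (((k : ℝ) ^ 4)⁻¹) + ENNReal.ofReal (((k : ℝ) ^ 4)⁻¹)) := by
        refine Finset.sum_le_sum fun j _ => Finset.sum_le_sum fun i _ => Finset.sum_le_sum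
          fun t ht => add_le_add ?_ ?_
        · exact hM.measure_deviation_le hμ hk1 j i (Finset.mem_Icc.1 ht).1 (by norm_num)
        · exact hM.measure_deviation_le hμ hk1 j i (Finset.mem_Icc.1 ht).1 (by norm_num)
    _ = ENNReal.ofReal (2 * U * C * ((k : ℝ) ^ 3)⁻¹) := by
        rw [← ENNReal.ofReal_add (by positivity) (by positivity)]
        simp only [Finset.sum_const, Finset.card_univ, Fintype.card_fin, Nat.card_Icc,
          nsmul_eq_mul, Nat.add_sub_cancel]
        rw [← ENNReal.ofReal_natCast k, ← ENNReal.ofReal_natCast C, ← ENNReal.ofReal_natCast U,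
          ← ENNReal.ofReal_mul (by positivity), ← ENNReal.ofReal_mul (by positivity),
          ← ENNReal.ofReal_mul (by positivity)]
        congr 1
        field_simp
        ring

end Concentration

/-! ### The logarithmic bound -/

section Logarithmic

variable {Ω : Type*} [MeasurableSpace Ω] {P : Measure Ω} {U C : ℕ}
  [NeZero U] {hUC : U ≤ C}
  {σ : (Fin C → ℝ) → Equiv.Perm (Fin C)} {init : Fin U → Equiv.Perm (Fin C)}
  {μ : Fin C → ℝ} {W : ℕ → Fin C → Ω → Bool} {D : ℕ → Fin U → Ω → Fin U}
  {k₀ L : ℕ} {δ : ℝ} {N : ℕ}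

/-- Each counted slot raises the counter by one, and none is counted once the counter has reached
`L`. -/
theorem card_sensed_lt_le (v : ℕ → Input U C) (j : Fin U) (i : Fin C) (n : ℕ) :
    ((Finset.range n).filter fun k => runChannel hUC σ init v k j = i ∧
      (runState hUC σ init v k).sensed j i < L).card ≤
      min ((runState hUC σ init v n).sensed j i) L := by
  induction n with
  | zero => simp
  | succ n ih =>
    rw [Finset.card_filter] at ih ⊢
    rw [Finset.sum_range_succ, runState_succ]
    by_cases h1 : runChannel hUC σ init v n j = i <;>
      by_cases h2 : (runState hUC σ init v n).sensed j i < L <;>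
      simp only [h1, h2, true_and, false_and, if_true, if_false] <;> omega

open Classical in
/-- The slots in which some user explores are at most `U * C * L` in number. -/
theorem card_not_exploits_le (v : ℕ → Input U C) (n : ℕ) :
    ((Finset.range n).filter fun k => ¬ Exploits hUC σ init L v k).card ≤ U * C * L := by
  have hsub : ((Finset.range n).filter fun k => ¬ Exploits hUC σ init L v k) ⊆
      (Finset.univ : Finset (Fin U × Fin C)).biUnion fun p =>
        (Finset.range n).filter fun k => runChannel hUC σ init v k p.1 = p.2 ∧
          (runState hUC σ init v k).sensed p.1 p.2 < L := by
    intro k hk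
    rw [Finset.mem_filter] at hk
    obtain ⟨hk, hk'⟩ := hk
    unfold Exploits at hk'
    push Not at hk'
    obtain ⟨j, hj⟩ := hk'
    simp only [Finset.mem_biUnion, Finset.mem_univ, true_and, Finset.mem_filter]
    exact ⟨(j, runChannel hUC σ init v k j), hk, rfl, hj⟩
  calc _ ≤ _ := Finset.card_le_card hsub
    _ ≤ _ := Finset.card_biUnion_le
    _ ≤ ∑ _p : Fin U × Fin C, L := Finset.sum_le_sum fun p _ =>
        (card_sensed_lt_le v p.1 p.2 n).trans (min_le_right _ _)
    _ = U * C * L := by simp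

/-- The expected number of slots in which a predicate holds. -/
theorem sum_measure_eq_lintegral_card {A : ℕ → Ω → Prop} [∀ k ω, Decidable (A k ω)] (hA : ∀ k, MeasurableSet {ω | A k ω})
    (n : ℕ) :
    ∑ k ∈ Finset.range n, P {ω | A k ω} =
      ∫⁻ ω, (((Finset.range n).filter fun k => A k ω).card : ℝ≥0∞) ∂P := by
  simp_rw [Finset.card_filter]
  push_cast
  rw [lintegral_finsetSum _ fun k _ => Measurable.ite (hA k) measurable_const measurable_const]
  refine Finset.sum_congr rfl fun k _ => ?_
  rw [← lintegral_indicator_one (hA k)]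
  exact lintegral_congr fun ω => by simp [Set.indicator_apply]

theorem IsModel.measurableSet_regular (hM : IsModel P μ W D) (k : ℕ) :
    MeasurableSet {ω | Regular hUC σ init μ k₀ L (inputs W D ω) k} :=
  hM.measurableSet_of_dependsOn (dependsOn_regular (Nat.lt_succ_self k))

theorem IsModel.measurableSet_active (hM : IsModel P μ W D) (k : ℕ) :
    MeasurableSet {ω | Active hUC σ init μ k₀ L (inputs W D ω) k} :=
  hM.measurableSet_of_dependsOn (dependsOn_active (Nat.lt_succ_self k))

theorem IsModel.measurableSet_quiet (hM : IsModel P μ W D) (k : ℕ) :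
    MeasurableSet {ω | Quiet hUC σ init μ k₀ L (inputs W D ω) k} :=
  hM.measurableSet_of_dependsOn (dependsOn_quiet (Nat.lt_succ_self k))

theorem summable_inv_cube : Summable fun k : ℕ => ((k : ℝ) ^ 3)⁻¹ :=
  Real.summable_nat_pow_inv.2 (by norm_num)

/-- The expected number of irregular slots. -/
theorem IsModel.sum_measure_not_regular_le [IsProbabilityMeasure P]
    (hM : IsModel P μ W D)
    (hμ : ∀ i, μ i ∈ Set.Ioo (0 : ℝ) 1) (ht : Thresholds μ δ k₀ L N) (n : ℕ) :
    ∑ k ∈ Finset.range n, P {ω | ¬ Regular hUC σ init μ k₀ L (inputs W D ω) k} ≤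
      ENNReal.ofReal (k₀ + 2 * U * C * ∑' k : ℕ, ((k : ℝ) ^ 3)⁻¹ + U * C * L) := by
  classical
  have hexp : ∀ k, MeasurableSet {ω | ¬ Exploits hUC σ init L (inputs W D ω) k} := fun k =>
    hM.measurableSet_of_dependsOn (k := k + 1) (A := fun v => ¬ Exploits hUC σ init L v k)
      (dependsOn_of_runState_prod hUC σ init (Nat.lt_succ_self k) fun s x =>
        ¬ ∀ j, L ≤ s.sensed j (slotChannel hUC σ init k s x.2 j))
  have h1 : ∀ k, P {ω | ¬ Regular hUC σ init μ k₀ L (inputs W D ω) k} ≤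
      (if k < k₀ then 1 else 0) + ENNReal.ofReal (2 * U * C * ((k : ℝ) ^ 3)⁻¹) +
        P {ω | ¬ Exploits hUC σ init L (inputs W D ω) k} := by
    intro k
    by_cases hk : k < k₀
    · rw [if_pos hk, add_assoc]
      exact prob_le_one.trans le_self_add
    · rw [if_neg hk, zero_add]
      have hCk : C ≤ k := ht.le.trans (not_lt.1 hk)
      refine le_trans ?_ (add_le_add (hM.measure_not_confident_le
        (hUC := hUC) (σ := σ) (init := init) hμ hCk) le_rfl)
      refine le_trans (measure_mono ?_) (measure_union_le _ _)
      intro ω hω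
      have hω' : ¬ Regular hUC σ init μ k₀ L (inputs W D ω) k := hω
      by_contra hcon
      rw [Set.mem_union, not_or] at hcon
      exact hω' ⟨⟨not_lt.1 hk, not_not.1 hcon.1⟩, not_not.1 hcon.2⟩
  have h2 : ∑ k ∈ Finset.range n, (if k < k₀ then (1 : ℝ≥0∞) else 0) ≤ k₀ := by
    rw [← Finset.sum_filter]
    simp only [Finset.sum_const, nsmul_eq_mul, mul_one]
    refine Nat.cast_le.2 ?_
    calc ((Finset.range n).filter fun k => k < k₀).card ≤ (Finset.range k₀).card :=
          Finset.card_le_card fun k hk => Finset.mem_range.2 (Finset.mem_filter.1 hk).2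
      _ = k₀ := Finset.card_range _
  have h3 : ∑ k ∈ Finset.range n, ENNReal.ofReal (2 * U * C * ((k : ℝ) ^ 3)⁻¹) ≤
      ENNReal.ofReal (2 * U * C * ∑' k : ℕ, ((k : ℝ) ^ 3)⁻¹) := by
    rw [← ENNReal.ofReal_sum_of_nonneg fun k _ => by positivity, ← Finset.mul_sum]
    exact ENNReal.ofReal_le_ofReal (mul_le_mul_of_nonneg_left
      (summable_inv_cube.sum_le_tsum _ fun k _ => by positivity) (by positivity))
  have h4 : ∑ k ∈ Finset.range n, P {ω | ¬ Exploits hUC σ init L (inputs W D ω) k} ≤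
      (U * C * L : ℕ) := by
    rw [sum_measure_eq_lintegral_card (A := fun k ω => ¬ Exploits hUC σ init L (inputs W D ω) k)
      hexp]
    calc ∫⁻ ω, (((Finset.range n).filter fun k =>
            ¬ Exploits hUC σ init L (inputs W D ω) k).card : ℝ≥0∞) ∂P
        ≤ ∫⁻ _, ((U * C * L : ℕ) : ℝ≥0∞) ∂P := lintegral_mono fun ω =>
          Nat.cast_le.2 (card_not_exploits_le (inputs W D ω) n)
      _ = (U * C * L : ℕ) := by rw [lintegral_const, measure_univ, mul_one]
  have hts : 0 ≤ ∑' k : ℕ, ((k : ℝ) ^ 3)⁻¹ := tsum_nonneg fun k => by positivity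
  calc _ ≤ _ := Finset.sum_le_sum fun k _ => h1 k
    _ ≤ (k₀ : ℝ≥0∞) + ENNReal.ofReal (2 * U * C * ∑' k : ℕ, ((k : ℝ) ^ 3)⁻¹) +
        (U * C * L : ℕ) := by
        rw [Finset.sum_add_distrib, Finset.sum_add_distrib]
        exact add_le_add (add_le_add h2 h3) h4
    _ = _ := by
        rw [ENNReal.ofReal_add (by positivity) (by positivity),
          ENNReal.ofReal_add (by positivity) (by positivity), ENNReal.ofReal_natCast,
          ← ENNReal.ofReal_natCast (U * C * L)]
        push_cast
        rfl

/-- The expected number of active slots is bounded by that of irregular ones. -/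
theorem IsModel.sum_measure_active_le [IsProbabilityMeasure P]
    (hM : IsModel P μ W D) (hμ : ∀ i, μ i ∈ Set.Ioo (0 : ℝ) 1)
    (hσ : IsRankingRule σ) {n : ℕ} (ht : Thresholds μ δ k₀ L (n + 2)) :
    ∑ k ∈ Finset.range n, P {ω | Active hUC σ init μ k₀ L (inputs W D ω) k} ≤
      (U : ℝ≥0∞) ^ (2 * U) * (3 * ∑ k ∈ Finset.range (n + 2),
        P {ω | ¬ Regular hUC σ init μ k₀ L (inputs W D ω) k} + 1) := by
  classical
  set R := ∑ k ∈ Finset.range (n + 2), P {ω | ¬ Regular hUC σ init μ k₀ L (inputs W D ω) k} with hR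
  have hU0 : (U : ℝ≥0∞) ≠ 0 := by exact_mod_cast NeZero.ne U
  have hmreg : ∀ k, MeasurableSet {ω | ¬ Regular hUC σ init μ k₀ L (inputs W D ω) k} :=
    fun k => (hM.measurableSet_regular k).compl
  have hshift : ∀ m ≤ 2, ∑ k ∈ Finset.range n,
      P {ω | ¬ Regular hUC σ init μ k₀ L (inputs W D ω) (k + m)} ≤ R := by
    intro m hm
    rw [hR, ← Finset.sum_image (g := fun k => k + m)
      (f := fun k => P {ω | ¬ Regular hUC σ init μ k₀ L (inputs W D ω) k})
      (fun _ _ _ _ h => Nat.add_right_cancel h)]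
    refine Finset.sum_le_sum_of_subset fun k hk => ?_
    obtain ⟨k', hk', rfl⟩ := Finset.mem_image.1 hk
    have := Finset.mem_range.1 hk'
    exact Finset.mem_range.2 (by omega)
  have hAQ : ∑ k ∈ Finset.range n, P {ω | Active hUC σ init μ k₀ L (inputs W D ω) k ∧
      Quiet hUC σ init μ k₀ L (inputs W D ω) (k + 1)} ≤ R + 1 := by
    rw [sum_measure_eq_lintegral_card (A := fun k ω =>
      Active hUC σ init μ k₀ L (inputs W D ω) k ∧
        Quiet hUC σ init μ k₀ L (inputs W D ω) (k + 1)) fun k =>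
      (hM.measurableSet_active k).inter (hM.measurableSet_quiet (k + 1))]
    calc _ ≤ ∫⁻ ω, ((((Finset.range (n + 2)).filter fun k =>
            ¬ Regular hUC σ init μ k₀ L (inputs W D ω) k).card : ℝ≥0∞) + 1) ∂P := by
          refine lintegral_mono fun ω => ?_
          have h := card_active_quiet_le (hUC := hUC) (init := init) ht hσ (inputs W D ω)
            (n := n) (by omega)
          have h' : ((Finset.range (n + 1)).filter fun k =>
              ¬ Regular hUC σ init μ k₀ L (inputs W D ω) k).card ≤
              ((Finset.range (n + 2)).filter fun k =>
              ¬ Regular hUC σ init μ k₀ L (inputs W D ω) k).card :=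
            Finset.card_le_card (Finset.filter_subset_filter _ (Finset.range_mono (by omega)))
          have h'' : (if Quiet hUC σ init μ k₀ L (inputs W D ω) n then 1 else 0) ≤ 1 := by
            split_ifs <;> simp
          rw [← Nat.cast_add_one]
          exact Nat.cast_le.2 (h.trans (add_le_add h' h''))
      _ = R + 1 := by
          rw [lintegral_add_right _ measurable_const, ← sum_measure_eq_lintegral_card
            (A := fun k ω => ¬ Regular hUC σ init μ k₀ L (inputs W D ω) k) hmreg]
          simp [hR]
  have hkey : (∑ k ∈ Finset.range n, P {ω | Active hUC σ init μ k₀ L (inputs W D ω) k}) *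
      (((U : ℝ≥0∞)⁻¹) ^ U * ((U : ℝ≥0∞)⁻¹) ^ U) ≤ 3 * R + 1 := by
    calc _ = ∑ k ∈ Finset.range n, P {ω | Active hUC σ init μ k₀ L (inputs W D ω) k} *
          ((U : ℝ≥0∞)⁻¹) ^ U * ((U : ℝ≥0∞)⁻¹) ^ U := by
          rw [Finset.sum_mul]
          exact Finset.sum_congr rfl fun k _ => (mul_assoc _ _ _).symm
      _ ≤ ∑ k ∈ Finset.range n, (P {ω | ¬ Regular hUC σ init μ k₀ L (inputs W D ω) (k + 1)} +
          P {ω | ¬ Regular hUC σ init μ k₀ L (inputs W D ω) (k + 2)} +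
          P {ω | Active hUC σ init μ k₀ L (inputs W D ω) k ∧
            Quiet hUC σ init μ k₀ L (inputs W D ω) (k + 1)}) := by
          refine Finset.sum_le_sum fun k hk => ?_
          have := Finset.mem_range.1 hk
          refine (hM.measure_active_le hμ ht hσ (by omega)).trans ?_
          refine le_trans (measure_mono ?_) ((measure_union_le _ _).trans
            (add_le_add (measure_union_le _ _) le_rfl))
          rintro ω ⟨ha, h | h | h⟩
          · exact Or.inl (Or.inl h)
          · exact Or.inl (Or.inr h)
          · exact Or.inr ⟨ha, h⟩
      _ ≤ R + R + (R + 1) := by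
          rw [Finset.sum_add_distrib, Finset.sum_add_distrib]
          exact add_le_add (add_le_add (hshift 1 (by omega)) (hshift 2 le_rfl)) hAQ
      _ = 3 * R + 1 := by ring
  have hinv : (U : ℝ≥0∞) ^ (2 * U) * (((U : ℝ≥0∞)⁻¹) ^ U * ((U : ℝ≥0∞)⁻¹) ^ U) = 1 := by
    rw [← pow_add, ← two_mul, ← mul_pow, ENNReal.mul_inv_cancel hU0 (ENNReal.natCast_ne_top U),
      one_pow]
  calc _ = (U : ℝ≥0∞) ^ (2 * U) *
        ((∑ k ∈ Finset.range n, P {ω | Active hUC σ init μ k₀ L (inputs W D ω) k}) *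
          (((U : ℝ≥0∞)⁻¹) ^ U * ((U : ℝ≥0∞)⁻¹) ^ U)) := by
        rw [mul_left_comm, hinv, mul_one]
    _ ≤ _ := mul_le_mul_right hkey _

/-- The expected number of collisions in terms of the thresholds. -/
theorem IsModel.lintegral_collisions_le_of_thresholds [IsProbabilityMeasure P]
    (hM : IsModel P μ W D)
    (hμ : ∀ i, μ i ∈ Set.Ioo (0 : ℝ) 1) (hσ : IsRankingRule σ) {n : ℕ}
    (ht : Thresholds μ δ k₀ L (n + 2)) {ρ : ℝ}
    (hρ : k₀ + 2 * U * C * ∑' k : ℕ, ((k : ℝ) ^ 3)⁻¹ + U * C * L ≤ ρ) :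
    ∫⁻ ω, (collisions hUC σ init μ (fun k i => W k i ω) (fun k j => D k j ω) n : ℝ≥0∞) ∂P ≤
      ENNReal.ofReal (U * ((U : ℝ) ^ (2 * U) * (3 * ρ + 1) + ρ)) := by
  classical
  have hts : 0 ≤ ∑' k : ℕ, ((k : ℝ) ^ 3)⁻¹ := tsum_nonneg fun k => by positivity
  have hρ0 : 0 ≤ ρ := le_trans (by positivity) hρ
  have hR : ∀ m, ∑ k ∈ Finset.range m, P {ω | ¬ Regular hUC σ init μ k₀ L (inputs W D ω) k} ≤
      ENNReal.ofReal ρ := fun m =>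
    (hM.sum_measure_not_regular_le hμ ht m).trans (ENNReal.ofReal_le_ofReal hρ)
  have hmreg : ∀ k, MeasurableSet {ω | ¬ Regular hUC σ init μ k₀ L (inputs W D ω) k} :=
    fun k => (hM.measurableSet_regular k).compl
  have hmA : ∀ k, MeasurableSet {ω | Active hUC σ init μ k₀ L (inputs W D ω) k} :=
    hM.measurableSet_active
  have hmi : ∀ {A : Ω → Prop} [DecidablePred A], MeasurableSet {ω | A ω} →
      Measurable fun ω => if A ω then (1 : ℝ≥0∞) else 0 :=
    fun h => Measurable.ite h measurable_const measurable_const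
  have hInt : ∀ {A : Ω → Prop} [DecidablePred A], MeasurableSet {ω | A ω} →
      ∫⁻ ω, (if A ω then (1 : ℝ≥0∞) else 0) ∂P = P {ω | A ω} := by
    intro A _ h
    rw [← lintegral_indicator_one h]
    exact lintegral_congr fun ω => by simp [Set.indicator_apply]
  have hms : ∀ k, Measurable fun ω =>
      (if Active hUC σ init μ k₀ L (inputs W D ω) k then (1 : ℝ≥0∞) else 0) +
        (if ¬ Regular hUC σ init μ k₀ L (inputs W D ω) k then (1 : ℝ≥0∞) else 0) :=
    fun k => (hmi (hmA k)).add (hmi (hmreg k))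
  calc ∫⁻ ω, (collisions hUC σ init μ (fun k i => W k i ω) (fun k j => D k j ω) n : ℝ≥0∞) ∂P
      ≤ ∫⁻ ω, U * ∑ k ∈ Finset.range n,
        ((if Active hUC σ init μ k₀ L (inputs W D ω) k then 1 else 0) +
          (if ¬ Regular hUC σ init μ k₀ L (inputs W D ω) k then 1 else 0)) ∂P := by
        refine lintegral_mono fun ω => collisions_le_sum (inputs W D ω) n _ fun k _ hk => ?_
        by_cases h : Regular hUC σ init μ k₀ L (inputs W D ω) k
        · rw [if_pos ⟨h, hk⟩]
          exact le_self_add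
        · rw [if_pos h]
          exact le_add_self
    _ = U * (∑ k ∈ Finset.range n, P {ω | Active hUC σ init μ k₀ L (inputs W D ω) k} +
        ∑ k ∈ Finset.range n, P {ω | ¬ Regular hUC σ init μ k₀ L (inputs W D ω) k}) := by
        rw [lintegral_const_mul _ (Finset.measurable_fun_sum _ fun k _ => hms k),
          lintegral_finsetSum _ fun k _ => hms k, ← Finset.sum_add_distrib]
        congr 1
        refine Finset.sum_congr rfl fun k _ => ?_
        rw [lintegral_add_left (hmi (hmA k)), hInt (hmA k), hInt (hmreg k)]
    _ ≤ U * ((U : ℝ≥0∞) ^ (2 * U) * (3 * ENNReal.ofReal ρ + 1) + ENNReal.ofReal ρ) := by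
        refine mul_le_mul_right (add_le_add ?_ (hR n)) _
        refine (hM.sum_measure_active_le hμ hσ ht).trans ?_
        gcongr
        exact hR _
    _ = _ := by
        rw [ENNReal.ofReal_mul (by positivity), ENNReal.ofReal_add (by positivity) hρ0,
          ENNReal.ofReal_mul (by positivity), ENNReal.ofReal_add (by positivity) zero_le_one,
          ENNReal.ofReal_mul (by positivity), ENNReal.ofReal_pow (by positivity)]
        simp

end Logarithmic

/-! ### Choice of the constants -/

theorem exists_separation {C : ℕ} (μ : Fin C → ℝ) :
    ∃ δ > 0, ∀ i i', μ i < μ i' → μ i + δ ≤ μ i' := by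
  let S : Finset ℝ := (Finset.univ.filter fun p : Fin C × Fin C => μ p.1 < μ p.2).image
    fun p => μ p.2 - μ p.1
  have hS : ∀ x ∈ insert 1 S, 0 < x := by
    intro x hx
    rcases Finset.mem_insert.1 hx with rfl | hx
    · exact one_pos
    · obtain ⟨p, hp, rfl⟩ := Finset.mem_image.1 hx
      exact sub_pos.2 (Finset.mem_filter.1 hp).2
  refine ⟨(insert 1 S).min' (Finset.insert_nonempty _ _), hS _ (Finset.min'_mem _ _),
    fun i i' h => ?_⟩
  have : (insert 1 S).min' (Finset.insert_nonempty _ _) ≤ μ i' - μ i :=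
    Finset.min'_le _ _ (Finset.mem_insert_of_mem (Finset.mem_image.2
      ⟨(i, i'), Finset.mem_filter.2 ⟨Finset.mem_univ _, h⟩, rfl⟩))
  linarith

end RhoRand

end

theorem mainTheorem3 (U C : ℕ) [NeZero U] (hUC : U ≤ C) (μ : Fin C → ℝ)
    (hμ : ∀ i, μ i ∈ Set.Ioo (0 : ℝ) 1) (hμ_inj : Function.Injective μ) :
    RhoRand.expectedUpsilon U < ∞ ∧
    ∃ (c : ℝ) (n₀ : ℕ), ∀ (Ω : Type*) [MeasurableSpace Ω] (P : Measure Ω) [IsProbabilityMeasure P]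
      (W : ℕ → Fin C → Ω → Bool) (D : ℕ → Fin U → Ω → Fin U), RhoRand.IsModel P μ W D →
      ∀ (σ : (Fin C → ℝ) → Equiv.Perm (Fin C)), RhoRand.IsRankingRule σ →
      ∀ (init : Fin U → Equiv.Perm (Fin C)),
        (∀ n : ℕ,
          ∫⁻ ω, (RhoRand.collisions hUC σ init μ (fun k i => W k i ω) (fun k j => D k j ω) n : ℝ≥0∞) ∂P
            ≤ U * (RhoRand.expectedUpsilon U + 1) *
              ∫⁻ ω, (RhoRand.wrongSlots hUC σ init μ (fun k i => W k i ω) (fun k j => D k j ω) n : ℝ≥0∞) ∂P) ∧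
        ∀ n : ℕ, n₀ ≤ n →
          ∫⁻ ω, (RhoRand.collisions hUC σ init μ (fun k i => W k i ω) (fun k j => D k j ω) n : ℝ≥0∞) ∂P
            ≤ ENNReal.ofReal (c * Real.log n) := by
  refine ⟨RhoRand.expectedUpsilon_lt_top U, ?_⟩
  obtain ⟨δ, hδ, hsep⟩ := RhoRand.exists_separation μ
  obtain ⟨k₁, hk₁⟩ := RhoRand.exists_sqrt_two_log_growth (half_pos hδ)
  set κ : ℝ := ∑' k : ℕ, ((k : ℝ) ^ 3)⁻¹ with hκ
  have hκ0 : 0 ≤ κ := tsum_nonneg fun k => by positivity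
  set k₀ : ℕ := max C k₁ with hk₀
  -- For `n ≥ 2` one has `1 ≤ 2 * log n`, which doubles the constant terms. From `log (n + 2) ≤ 2 *
  -- log n` the sample threshold is at most `64 / δ ^ 2 * log n + 1`, and rounding up is absorbed by
  -- the `2`.
  set ρ : ℝ := 2 * k₀ + 4 * U * C * κ + U * C * (64 / δ ^ 2 + 2) with hρ
  -- The constants are fixed before the probability space, the tie-breaking rule and the initial
  -- orders. The value `2` ensures `n + 2 ≤ n ^ 2`, and the summand `2` after `3 * ρ` absorbs the
  -- additive one.
  refine ⟨U * ((U : ℝ) ^ (2 * U) * (3 * ρ + 2) + ρ), 2, ?_⟩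
  intro Ω _ P _ W D hM σ hσ init
  refine ⟨fun n => hM.lintegral_collisions_le hμ n, fun n hn => ?_⟩
  have hn' : (2 : ℝ) ≤ n := by exact_mod_cast hn
  set L : ℕ := ⌈32 * Real.log ((n + 2 : ℕ) : ℝ) / δ ^ 2⌉₊ with hL
  have hlog1 : 1 ≤ 2 * Real.log n := by
    have h1 := Real.log_le_log (by norm_num) hn'
    have h2 := Real.log_two_gt_d9
    linarith
  have hlog2 : Real.log ((n + 2 : ℕ) : ℝ) ≤ 2 * Real.log n := by
    rw [← Real.log_rpow (by linarith) 2]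
    refine Real.log_le_log (by positivity) ?_
    push_cast
    norm_cast
    nlinarith
  have hlog0 : 0 ≤ Real.log ((n + 2 : ℕ) : ℝ) :=
    Real.log_nonneg (by push_cast; linarith)
  have ht : RhoRand.Thresholds μ δ k₀ L (n + 2) :=
    { injective := hμ_inj
      pos := hδ
      sep := hsep
      le := le_max_left _ _
      growth := fun k hk => hk₁ k ((le_max_right _ _).trans hk)
      samples := by
        have := Nat.le_ceil (32 * Real.log ((n + 2 : ℕ) : ℝ) / δ ^ 2)
        rw [div_le_iff₀ (by positivity)] at this
        linarith }
  have hLle : (L : ℝ) ≤ (64 / δ ^ 2 + 2) * Real.log n := by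
    have h1 := (Nat.ceil_lt_add_one (div_nonneg (mul_nonneg (by norm_num : (0 : ℝ) ≤ 32) hlog0)
      (sq_nonneg δ))).le
    have h2 : 32 * Real.log ((n + 2 : ℕ) : ℝ) / δ ^ 2 ≤ 32 * (2 * Real.log n) / δ ^ 2 := by
      gcongr
    have h3 : 32 * (2 * Real.log n) / δ ^ 2 = 64 / δ ^ 2 * Real.log n := by ring
    rw [← hL] at h1
    linarith
  have hbound : k₀ + 2 * U * C * κ + U * C * L ≤ ρ * Real.log n := by
    have h1 : (k₀ + 2 * U * C * κ) * 1 ≤ (k₀ + 2 * U * C * κ) * (2 * Real.log n) :=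
      mul_le_mul_of_nonneg_left hlog1 (by positivity)
    have h2 : (U * C : ℝ) * L ≤ U * C * ((64 / δ ^ 2 + 2) * Real.log n) :=
      mul_le_mul_of_nonneg_left hLle (by positivity)
    rw [hρ]
    linarith
  refine (hM.lintegral_collisions_le_of_thresholds hμ hσ ht hbound).trans
    (ENNReal.ofReal_le_ofReal ?_)
  calc (U : ℝ) * ((U : ℝ) ^ (2 * U) * (3 * (ρ * Real.log n) + 1) + ρ * Real.log n)
      ≤ U * ((U : ℝ) ^ (2 * U) * (3 * (ρ * Real.log n) + 2 * Real.log n) + ρ * Real.log n) := by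
        gcongr
    _ = U * ((U : ℝ) ^ (2 * U) * (3 * ρ + 2) + ρ) * Real.log n := by ring
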